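/- Let $S$ be a set of colors and let $\underline{x}=s_1s_2\cdots s_d$, $d\ge 1$, be a sequence in $S$, regarded up to rotation. A \emph{Soergel graph on the planar disk with boundary $\underline{x}$} is a finite graph embedded in the closed disk, considered up to isotopy, whose edges are colored by $S$. Its vertices are univalent (\emph{dots}) or trivalent, and the edges meeting at a vertex have the same color. Closed circles without vertices are allowed. Edges may end on the boundary circle, and the colors at the boundary points, read cyclically, are $s_1,\dots,s_d$ (boundary points are not vertices). Homogeneous polynomials, from a polynomial ring graded so that linear terms have degree $2$, may be placed in the regions. The \emph{degree} of the graph is the number of dots, minus the number of trivalent vertices, plus the degrees of the polynomials. The graph \emph{contains only simple trees} if each connected component is a tree which meets the boundary and which contains a dot precisely when it meets the boundary in a single point, in which case it has no trivalent vertices. It is \emph{maximally connected} if it contains only simple trees, has no polynomials, and, for each $s\in S$, each region of the complement in the disk of the edges of color different from $s$ contains at most one connected component colored $s$. An \emph{$S$-colored crossingless matching} with $d$ endpoints consists of disjoint embedded arcs in the disk which match up $d$ points of the boundary circle, one between any two cyclically consecutive boundary points of the graph, together with a coloring by $S$ of the regions they cut out such that adjacent regions have different colors. A Soergel graph is a \emph{deformation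 retract} of such a matching if it contains only simple trees and no polynomials, and its connected components correspond bijectively to the regions of the matching, the tree of a region having the color of the region and ending exactly at the boundary points of the graph lying in that region (the choice of a tree with a given boundary is irrelevant). Let $m$ be the number of indices $1\le i\le d$ with $s_i=s_{i+1}$, where $s_{d+1}=s_1$. Then every maximally connected Soergel graph on the disk with boundary $\underline{x}$ has degree at least $2-m$. Moreover, if $m=0$ and the graph has degree exactly $2$, then it is a deformation retract of some $S$-colored crossingless matching. -/

import Mathlib

open scoped unitInterval

noncomputable section

/-- The closed unit disk in the plane. -/
def closedDisk : Set ℂ := Metric.closedBall 0 1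

/-- The open unit disk in the plane. -/
def openDisk : Set ℂ := Metric.ball 0 1

/-- The `i`-th of `d` equally spaced points on the boundary circle, in counterclockwise order. -/
def boundaryPt (d : ℕ) (i : Fin d) : ℂ :=
  Complex.exp (2 * Real.pi * Complex.I * ((i : ℕ) : ℂ) / (d : ℂ))

/-- The point on the boundary circle halfway between `boundaryPt d i` and the next boundary
point. -/
def gapPt (d : ℕ) (i : Fin d) : ℂ :=
  Complex.exp (2 * Real.pi * Complex.I * (((i : ℕ) : ℂ) + 1 / 2) / (d : ℂ))

/-- The regions into which a subset `Γ` splits the disk: the connected components of the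
complement of `Γ` in the closed disk. -/
def IsRegion (Γ R : Set ℂ) : Prop :=
  ∃ z ∈ closedDisk \ Γ, R = connectedComponentIn (closedDisk \ Γ) z

/-- The position in the plane of a node, which is either a vertex or a boundary point. -/
def nodePosition {V : Type} (d : ℕ) (vertexPt : V → ℂ) : V ⊕ Fin d → ℂ :=
  Sum.elim vertexPt (boundaryPt d)

/-- The number of cyclic repetitions in `x = s₁ ⋯ s_d`, i.e. the number of `i` with
`sᵢ = sᵢ₊₁`, where `s_{d+1} = s₁`. -/
def repetitions {S : Type*} {d : ℕ} (x : Fin d → S) : ℕ :=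
  Nat.card {i : Fin d // x i = x (finRotate d i)}

/-- A Soergel graph on the planar disk with boundary `x`: a finite `S`-colored graph embedded in
the closed unit disk, with univalent vertices (dots), trivalent vertices, closed circles without
vertices, and edges which may end on the boundary circle; moreover some regions contain a
homogeneous polynomial.  Up to isotopy, the boundary points may be taken equally spaced.
The polynomial ring is `MvPolynomial ι 𝕜`, where `ι` indexes a basis of its linear terms. -/
structure SoergelGraph {S : Type*} (𝕜 : Type*) [CommRing 𝕜] (ι : Type*) {d : ℕ}
    (x : Fin d → S) where
  /-- The vertices (boundary points are not vertices). -/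
  V : Type
  /-- The edges other than circles. -/
  E : Type
  /-- The circles, i.e. the closed edges which meet no vertex. -/
  C : Type
  /-- The polynomials placed in regions. -/
  B : Type
  [fintypeV : Fintype V]
  [fintypeE : Fintype E]
  [fintypeC : Fintype C]
  [fintypeB : Fintype B]
  /-- The position of a vertex. -/
  vertexPt : V → ℂ
  /-- The two ends of an edge, each a vertex or a boundary point. -/
  endpt : E → Bool → V ⊕ Fin d
  /-- The embedding of an edge. -/
  arc : ∀ e : E, Path (nodePosition d vertexPt (endpt e false))
    (nodePosition d vertexPt (endpt e true))
  /-- The embedding of a circle. -/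
  circ : C → C(Circle, ℂ)
  /-- Vertices, boundary points, open edges and circles are embedded and pairwise disjoint. -/
  embedded : Function.Injective
    (Sum.elim (nodePosition d vertexPt)
      (Sum.elim (fun p : E × Set.Ioo (0 : I) 1 => arc p.1 p.2)
        (fun p : C × Circle => circ p.1 p.2)))
  vertexPt_mem : ∀ v, vertexPt v ∈ openDisk
  arc_mem : ∀ e, ∀ t ∈ Set.Ioo (0 : I) 1, arc e t ∈ openDisk
  circ_mem : ∀ c t, circ c t ∈ openDisk
  /-- Every vertex is univalent or trivalent. -/
  valence_vertex : ∀ v : V,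
    Nat.card {p : E × Bool // endpt p.1 p.2 = Sum.inl v} = 1 ∨
    Nat.card {p : E × Bool // endpt p.1 p.2 = Sum.inl v} = 3
  /-- At each boundary point exactly one edge ends. -/
  valence_boundary : ∀ i : Fin d, Nat.card {p : E × Bool // endpt p.1 p.2 = Sum.inr i} = 1
  /-- The color of an edge. -/
  edgeColor : E → S
  /-- The color of a circle. -/
  circleColor : C → S
  /-- Edges which meet at a vertex have the same color. -/
  color_vertex : ∀ e e' : E, ∀ b b' : Bool, ∀ v : V,
    endpt e b = Sum.inl v → endpt e' b' = Sum.inl v → edgeColor e = edgeColor e'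
  /-- The edge ending at the `i`-th boundary point has color `x i`. -/
  color_boundary : ∀ (e : E) (b : Bool) (i : Fin d), endpt e b = Sum.inr i → edgeColor e = x i
  /-- A polynomial placed in a region. -/
  poly : B → MvPolynomial ι 𝕜
  poly_homogeneous : ∀ b, ∃ n : ℕ, (poly b).IsHomogeneous n
  /-- The region in which a polynomial is placed. -/
  polyRegion : B → Set ℂ
  polyRegion_isRegion : ∀ b,
    IsRegion ((⋃ e, Set.range (arc e)) ∪ ⋃ c, Set.range (circ c)) (polyRegion b)
  polyRegion_injective : Function.Injective polyRegion

attribute [instance] SoergelGraph.fintypeV SoergelGraph.fintypeE SoergelGraph.fintypeC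
  SoergelGraph.fintypeB

namespace SoergelGraph

variable {S : Type*} {𝕜 : Type*} [CommRing 𝕜] {ι : Type*} {d : ℕ} {x : Fin d → S}

/-- The nodes of the graph: its vertices and its boundary points. -/
abbrev Node (G : SoergelGraph 𝕜 ι x) : Type := G.V ⊕ Fin d

/-- The number of edge ends at a vertex. -/
def valence (G : SoergelGraph 𝕜 ι x) (v : G.V) : ℕ :=
  Nat.card {p : G.E × Bool // G.endpt p.1 p.2 = Sum.inl v}

/-- The degree: `+1` for every dot, `-1` for every trivalent vertex, and the degree of every
polynomial, where linear polynomials have degree `2`. -/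
def degree (G : SoergelGraph 𝕜 ι x) : ℤ :=
  (Nat.card {v : G.V // G.valence v = 1} : ℤ) - (Nat.card {v : G.V // G.valence v = 3} : ℤ)
    + ∑ b, 2 * ((G.poly b).totalDegree : ℤ)

/-- The simple graph on the nodes in which two distinct nodes are adjacent when an edge joins
them.  (Circles are not seen by it.) -/
def skeleton (G : SoergelGraph 𝕜 ι x) : SimpleGraph G.Node :=
  SimpleGraph.fromRel (fun u v => ∃ e, G.endpt e false = u ∧ G.endpt e true = v)

/-- The connected components of the graph, apart from its circles. -/
abbrev Component (G : SoergelGraph 𝕜 ι x) : Type := G.skeleton.ConnectedComponent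

/-- The connected component of a node. -/
def comp (G : SoergelGraph 𝕜 ι x) (u : G.Node) : G.Component :=
  G.skeleton.connectedComponentMk u

/-- Every connected component is a tree: there are no circles, no loops, no multiple edges and
no further cycles. -/
structure OnlyTrees (G : SoergelGraph 𝕜 ι x) : Prop where
  no_circle : IsEmpty G.C
  no_loop : ∀ e, G.endpt e false ≠ G.endpt e true
  no_multiple_edge : Function.Injective (fun e => s(G.endpt e false, G.endpt e true))
  acyclic : G.skeleton.IsAcyclic

/-- The graph contains only simple trees: every connected component is a tree with nonempty
boundary, which contains a dot precisely when its boundary is a single point, in which case it has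
no trivalent vertices. -/
structure OnlySimpleTrees (G : SoergelGraph 𝕜 ι x) : Prop where
  trees : G.OnlyTrees
  boundary_nonempty : ∀ c : G.Component, ∃ i : Fin d, G.comp (Sum.inr i) = c
  dot_iff : ∀ c : G.Component,
    (∃ v : G.V, G.comp (Sum.inl v) = c ∧ G.valence v = 1) ↔ ∃! i : Fin d, G.comp (Sum.inr i) = c
  not_trivalent : ∀ c : G.Component, (∃! i : Fin d, G.comp (Sum.inr i) = c) →
    ∀ v : G.V, G.comp (Sum.inl v) = c → G.valence v ≠ 3

/-- The subgraph of all edges and circles whose color is different from `s`, as a subset of the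
disk. -/
def otherColors (G : SoergelGraph 𝕜 ι x) (s : S) : Set ℂ :=
  (⋃ e ∈ {e : G.E | G.edgeColor e ≠ s}, Set.range (G.arc e)) ∪
    ⋃ c ∈ {c : G.C | G.circleColor c ≠ s}, Set.range (G.circ c)

/-- A Soergel graph is maximally connected if it contains only simple trees, has no polynomials,
and for each color `s` every region of the complement of the edges not colored `s` contains at most
one connected component colored `s`. -/
structure MaximallyConnected (G : SoergelGraph 𝕜 ι x) : Prop where
  simple : G.OnlySimpleTrees
  no_poly : IsEmpty G.B
  one_component : ∀ (s : S) (R : Set ℂ), IsRegion (G.otherColors s) R →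
    ∀ e e' : G.E, G.edgeColor e = s → G.edgeColor e' = s →
      Set.range (G.arc e) ⊆ R → Set.range (G.arc e') ⊆ R →
        G.comp (G.endpt e false) = G.comp (G.endpt e' false)

end SoergelGraph

/-- An `S`-colored crossingless matching on the disk: disjoint embedded strands which match up
the `d` points `gapPt d i` of the boundary circle, and a coloring of the regions between the
strands such that any two adjacent regions have different colors. -/
structure ColoredCrossinglessMatching (S : Type*) (d : ℕ) where
  Strand : Type
  [fintypeStrand : Fintype Strand]
  endpt : Strand → Bool → Fin d
  /-- Each of the `d` points is the end of exactly one strand. -/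
  matched : ∀ i : Fin d, ∃! p : Strand × Bool, endpt p.1 p.2 = i
  arc : ∀ a : Strand, Path (gapPt d (endpt a false)) (gapPt d (endpt a true))
  /-- The strands are embedded and pairwise disjoint. -/
  embedded : Function.Injective (fun p : Strand × I => arc p.1 p.2)
  arc_mem : ∀ a, ∀ t ∈ Set.Ioo (0 : I) 1, arc a t ∈ openDisk
  /-- The color of a region. -/
  color : {R : Set ℂ // IsRegion (⋃ a, Set.range (arc a)) R} → S
  /-- Regions whose closures meet (necessarily along a strand) have different colors. -/
  color_adjacent : ∀ R R' : {R : Set ℂ // IsRegion (⋃ a, Set.range (arc a)) R}, R ≠ R' →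
    (closure (R : Set ℂ) ∩ closure (R' : Set ℂ)).Nonempty → color R ≠ color R'

namespace ColoredCrossinglessMatching

/-- The regions of a crossingless matching. -/
abbrev Region {S : Type*} {d : ℕ} (M : ColoredCrossinglessMatching S d) : Type :=
  {R : Set ℂ // IsRegion (⋃ a, Set.range (M.arc a)) R}

end ColoredCrossinglessMatching

/-- The graph `G` is obtained from the colored crossingless matching `M` by a deformation retract
of each colored region: `G` contains only simple trees, without polynomials, one for each region
of `M`, and the tree of a region `R` has the color of `R` and ends exactly at the boundary points
which lie in `R`.  The choice of the trees is irrelevant: any simple trees with the same boundary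
will do. -/
def SoergelGraph.IsDeformationRetractOf {S : Type*} {𝕜 : Type*} [CommRing 𝕜] {ι : Type*} {d : ℕ}
    {x : Fin d → S} (G : SoergelGraph 𝕜 ι x) (M : ColoredCrossinglessMatching S d) : Prop :=
  G.OnlySimpleTrees ∧ IsEmpty G.B ∧
    ∃ φ : M.Region ≃ G.Component,
      (∀ (R : M.Region) (i : Fin d), boundaryPt d i ∈ (R : Set ℂ) ↔ G.comp (Sum.inr i) = φ R) ∧
      (∀ (R : M.Region) (e : G.E), G.comp (G.endpt e false) = φ R → G.edgeColor e = M.color R)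

end

/-! A forest with univalent and trivalent vertices, `c` components, `d` boundary points and no
polynomials has degree `2c - d`, by the handshake lemma (`degree_eq`). So `c` has to be bounded
below. Distinct components are disjoint connected subsets of the disk, hence they partition the
boundary points without crossings (`comp_eq_of_interlaced`). The planar input is that two paths in
the disk with interlaced ends on the circle meet (`exists_eq_of_interlaced`), which is a winding
number count.

The bound itself is combinatorics of the complementary (Kreweras) partition. Two gaps are equivalent
when no chord joining two points of one block separates them; there are at least `d + 1 - c` classes
(`card_add_card_gapClasses`). A gap at which the color changes lies between distinct blocks, so it
is not alone in its class (`exists_ne_gapSetoid`). Hence a class of `n` gaps contains at most `2(n -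
1)` color changes, and summing gives `d - m ≤ 2d - 2(d + 1 - c) = 2c - 2` (`two_mul_card_sub_le`).

If `m = 0` and equality holds, every class has `n = 2(n - 1)`, so `n = 2`: the gaps are paired,
without crossings. Straight segments between partners form the matching. Its regions are cells cut
out by signs of affine functions, each containing a boundary point, and two boundary points share a
region exactly when they share a component (`exists_gapPairing`). -/

noncomputable section

/-! ### Interlaced paths in the disk meet -/

/-- A continuous logarithm `h` of a path `1 - w`, multiplied by a constant, where `w` runs in the
closed unit disk and avoids `1`, changes its imaginary part as the principal argument does. -/
theorem im_sub_im_eq_arg_sub_arg {h w : ℝ → ℂ} {c : ℂ} (hh : Continuous h) (hw : ∀ t, ‖w t‖ ≤ 1)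
    (hw1 : ∀ t, w t ≠ 1) (hc : ∀ t, c * Complex.exp (h t) = 1 - w t) (a b : ℝ) :
    (h b).im - (h a).im = (1 - w b).arg - (1 - w a).arg := by
  have hre : ∀ t, 0 < (1 - w t).re := by
    intro t
    have h1 : (w t).re ≤ 1 := (Complex.re_le_norm _).trans (hw t)
    rcases h1.lt_or_eq with h2 | h2
    · simpa using h2
    · refine absurd ?_ (hw1 t)
      have h3 : (w t).re ^ 2 + (w t).im ^ 2 ≤ 1 := by
        have := Complex.sq_norm (w t)
        rw [Complex.normSq_apply] at this
        nlinarith [hw t, norm_nonneg (w t)]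
      have h4 : (w t).im = 0 := by rw [h2] at h3; nlinarith
      exact Complex.ext (by simpa using h2) (by simpa using h4)
  have hsl : ∀ t, c * Complex.exp (h t) ∈ Complex.slitPlane := fun t => by
    rw [hc]; exact Or.inl (hre t)
  have hc0 : c ≠ 0 := by
    rintro rfl
    have := hre a
    rw [← hc a] at this
    simp at this
  let k : ℝ → ℂ := fun t => h t - Complex.log (c * Complex.exp (h t))
  have hk : Continuous k := hh.sub (Continuous.clog (by fun_prop) hsl)
  have hexp : ∀ t, Complex.exp (k t) = c⁻¹ := by
    intro t
    rw [Complex.exp_sub, Complex.exp_log (Complex.slitPlane_ne_zero (hsl t))]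
    field_simp
  -- Both sides lift the constant path `c⁻¹` through the covering `exp` and agree at `a`.
  have hkk : k = fun _ => k a :=
    Complex.isCoveringMap_exp.eq_of_comp_eq hk continuous_const
      (funext fun t => Subtype.ext (by simp [hexp])) a rfl
  have h5 := congrArg Complex.im (congrFun hkk b)
  simp only [k, Complex.sub_im, Complex.log_im, hc] at h5
  linarith

/-- This is the polar form `1 - exp (iφ) = 2 sin (φ/2) exp (i(φ - π)/2)`. For negative `φ` the value
shifts by `π`, and this jump is the source of the nonzero winding below. -/
theorem arg_one_sub_exp {φ : ℝ} (h0 : 0 < φ) (h1 : φ < 2 * Real.pi) :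
    (1 - Complex.exp (φ * Complex.I)).arg = (φ - Real.pi) / 2 := by
  have h : 1 - Complex.exp (φ * Complex.I) = ((2 * Real.sin (φ / 2) : ℝ) : ℂ) *
      (Complex.cos (((φ - Real.pi) / 2 : ℝ) : ℂ) +
        Complex.sin (((φ - Real.pi) / 2 : ℝ) : ℂ) * Complex.I) := by
    have e1 : (φ - Real.pi) / 2 = φ / 2 - Real.pi / 2 := by ring
    rw [← Complex.ofReal_cos, ← Complex.ofReal_sin, e1, Real.cos_sub_pi_div_two,
      Real.sin_sub_pi_div_two, Complex.exp_mul_I, ← Complex.ofReal_cos, ← Complex.ofReal_sin]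
    have e3 := Real.sin_sq_add_cos_sq (φ / 2)
    have e4 : Real.cos φ = 1 - 2 * Real.sin (φ / 2) ^ 2 := by
      have := Real.cos_two_mul (φ / 2)
      rw [mul_div_cancel₀ φ two_ne_zero] at this
      linarith
    have e5 : Real.sin φ = 2 * Real.sin (φ / 2) * Real.cos (φ / 2) := by
      rw [← Real.sin_two_mul, mul_div_cancel₀ φ two_ne_zero]
    rw [e4, e5]
    push_cast
    ring
  rw [h]
  refine Complex.arg_mul_cos_add_sin_mul_I ?_ ⟨by linarith, by linarith [Real.pi_pos]⟩
  have := Real.sin_pos_of_pos_of_lt_pi (x := φ / 2) (by linarith) (by linarith)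
  linarith

theorem arg_one_sub_exp_of_neg {φ : ℝ} (h0 : -(2 * Real.pi) < φ) (h1 : φ < 0) :
    (1 - Complex.exp (φ * Complex.I)).arg = (φ + Real.pi) / 2 := by
  have h2 : Complex.exp (φ * Complex.I) = Complex.exp ((φ + 2 * Real.pi : ℝ) * Complex.I) := by
    push_cast
    rw [add_mul, Complex.exp_periodic]
  rw [h2, arg_one_sub_exp (by linarith) (by linarith)]
  ring

/-- Two paths in the closed disk whose end points interlace on the boundary circle meet. -/
theorem exists_eq_of_interlaced {α κ β l : ℝ} (h1 : α < κ) (h2 : κ < β) (h3 : β < l)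
    (h4 : l < α + 2 * Real.pi)
    (γ : Path (Complex.exp (α * Complex.I)) (Complex.exp (β * Complex.I)))
    (δ : Path (Complex.exp (κ * Complex.I)) (Complex.exp (l * Complex.I)))
    (hγ : ∀ t, ‖γ t‖ ≤ 1) (hδ : ∀ t, ‖δ t‖ ≤ 1) : ∃ s t, γ s = δ t := by
  by_contra! hne
  have hγ' : ∀ t, ‖γ.extend t‖ ≤ 1 := fun t => hγ _
  have hδ' : ∀ t, ‖δ.extend t‖ ≤ 1 := fun t => hδ _
  have hne' : ∀ s t, γ.extend s ≠ δ.extend t := fun s t => hne _ _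
  -- The difference of the two paths has no zero on the simply connected plane, so it has a
  -- continuous logarithm.
  obtain ⟨G, hG, hGF⟩ : ∃ G : ℝ × ℝ → ℂ, Continuous G ∧
      ∀ p, Complex.exp (G p) = γ.extend p.1 - δ.extend p.2 := by
    obtain ⟨G, hG, hGF⟩ := Complex.exists_continuousOn_eqOn_exp_comp (X := ℝ × ℝ) (U := Set.univ)
      (g := fun p => γ.extend p.1 - δ.extend p.2)
      (by
        have : ContractibleSpace (Set.univ : Set (ℝ × ℝ)) :=
          convex_univ.contractibleSpace ⟨0, trivial⟩
        exact SimplyConnectedSpace.ofContractible _) isOpen_univ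
      (by
        have := γ.continuous_extend
        have := δ.continuous_extend
        fun_prop)
      (by
        rintro ⟨p, -, hp⟩
        exact hne' _ _ (sub_eq_zero.1 hp))
    exact ⟨G, by simpa using hG, fun p => hGF (Set.mem_univ p)⟩
  have hnorm : ∀ (θ : ℝ) (z : ℂ), ‖z‖ ≤ 1 → ‖Complex.exp ((-θ : ℝ) * Complex.I) * z‖ ≤ 1 := by
    intro θ z hz
    rw [norm_mul, Complex.norm_exp_ofReal_mul_I, one_mul]
    exact hz
  have hmul : ∀ θ φ : ℝ, Complex.exp ((-θ : ℝ) * Complex.I) * Complex.exp (φ * Complex.I) =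
      Complex.exp ((φ - θ : ℝ) * Complex.I) := by
    intro θ φ
    rw [← Complex.exp_add]
    congr 1
    push_cast
    ring
  have hone : ∀ θ : ℝ, Complex.exp ((-θ : ℝ) * Complex.I) * Complex.exp (θ * Complex.I) = 1 := by
    intro θ
    rw [hmul]; simp
  have hcancel : ∀ (θ : ℝ) (z : ℂ), Complex.exp ((-θ : ℝ) * Complex.I) * z = 1 →
      z = Complex.exp (θ * Complex.I) := fun θ z hz =>
    mul_left_cancel₀ (Complex.exp_ne_zero _) (hz.trans (hone θ).symm)
  -- On each side of the unit square one of the paths rests at an end point on the circle. Rotating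
  -- that point to `1` brings the difference to the form `1 - w`.
  have left := im_sub_im_eq_arg_sub_arg (h := fun t => G (0, t))
    (w := fun t => Complex.exp ((-α : ℝ) * Complex.I) * δ.extend t)
    (c := Complex.exp ((-α : ℝ) * Complex.I)) (by fun_prop) (fun t => hnorm _ _ (hδ' t))
    (fun t ht => hne' 0 t (by rw [hcancel _ _ ht]; simp))
    (fun t => by rw [hGF, mul_sub]; simp only [Path.extend_zero]; rw [hone]) 0 1
  have right := im_sub_im_eq_arg_sub_arg (h := fun t => G (1, t))
    (w := fun t => Complex.exp ((-β : ℝ) * Complex.I) * δ.extend t)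
    (c := Complex.exp ((-β : ℝ) * Complex.I)) (by fun_prop) (fun t => hnorm _ _ (hδ' t))
    (fun t ht => hne' 1 t (by rw [hcancel _ _ ht]; simp))
    (fun t => by rw [hGF, mul_sub]; simp only [Path.extend_one]; rw [hone]) 0 1
  have bot := im_sub_im_eq_arg_sub_arg (h := fun t => G (t, 0))
    (w := fun t => Complex.exp ((-κ : ℝ) * Complex.I) * γ.extend t)
    (c := -Complex.exp ((-κ : ℝ) * Complex.I)) (by fun_prop) (fun t => hnorm _ _ (hγ' t))
    (fun t ht => hne' t 0 (by rw [hcancel _ _ ht]; simp))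
    (fun t => by rw [hGF, neg_mul, mul_sub]; simp only [Path.extend_zero]; rw [hone]; ring) 0 1
  have top := im_sub_im_eq_arg_sub_arg (h := fun t => G (t, 1))
    (w := fun t => Complex.exp ((-l : ℝ) * Complex.I) * γ.extend t)
    (c := -Complex.exp ((-l : ℝ) * Complex.I)) (by fun_prop) (fun t => hnorm _ _ (hγ' t))
    (fun t ht => hne' t 1 (by rw [hcancel _ _ ht]; simp))
    (fun t => by rw [hGF, neg_mul, mul_sub]; simp only [Path.extend_one]; rw [hone]; ring) 0 1
  simp only [Path.extend_zero, Path.extend_one, hmul] at left right bot top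
  rw [arg_one_sub_exp (by linarith) (by linarith), arg_one_sub_exp (by linarith) (by linarith)]
    at left
  rw [arg_one_sub_exp (by linarith) (by linarith),
    arg_one_sub_exp_of_neg (by linarith) (by linarith)] at right
  rw [arg_one_sub_exp (by linarith) (by linarith),
    arg_one_sub_exp_of_neg (by linarith) (by linarith)] at bot
  rw [arg_one_sub_exp_of_neg (by linarith) (by linarith),
    arg_one_sub_exp_of_neg (by linarith) (by linarith)] at top
  -- The increments are `(l - κ)/2` on the left, `(l - κ)/2 - π` on the right, `(β - α)/2 - π` at
  -- the bottom and `(β - α)/2` at the top. Around the square they add up to `-2π` instead of `0`.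
  linarith [Real.pi_pos]

/-! ### Degree and colors of a forest -/

/-- The handshake lemma for forests. -/
theorem SimpleGraph.IsAcyclic.sum_card_neighborSet {V : Type*} [Fintype V] {G : SimpleGraph V}
    (hG : G.IsAcyclic) :
    ∑ v, Nat.card (G.neighborSet v) + 2 * Nat.card G.ConnectedComponent = 2 * Fintype.card V := by
  classical
  have htree : ∀ c : G.ConnectedComponent,
      ∑ v : c, Nat.card (G.neighborSet v) + 2 = 2 * Fintype.card c := by
    intro c
    have h1 := c.toSimpleGraph.sum_degrees_eq_twice_card_edges
    have h2 := (hG.isTree_connectedComponent c).card_edgeFinset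
    have h3 : ∀ v : c, Nat.card (G.neighborSet v) = c.toSimpleGraph.degree v := by
      intro v
      rw [← SimpleGraph.card_neighborSet_eq_degree, ← Nat.card_eq_fintype_card]
      refine Nat.card_congr ⟨fun w => ⟨⟨w, ?_⟩, ?_⟩, fun w => ⟨w, ?_⟩, fun w => rfl, fun w => rfl⟩
      · exact (c.mem_supp_congr_adj w.2).1 v.2
      · exact w.2
      · exact w.2
    rw [Finset.sum_congr rfl fun v _ => h3 v, h1, ← h2]
    ring
  have h1 : ∑ v, Nat.card (G.neighborSet v) =
      ∑ c : G.ConnectedComponent, ∑ v : c, Nat.card (G.neighborSet v) := by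
    rw [← Fintype.sum_sigma' (fun (c : G.ConnectedComponent) (v : c) =>
      Nat.card (G.neighborSet v))]
    exact Fintype.sum_equiv (Equiv.sigmaFiberEquiv G.connectedComponentMk).symm _ _ fun v => rfl
  have h2 : Fintype.card V = ∑ c : G.ConnectedComponent, Fintype.card c := by
    rw [← Fintype.card_sigma]
    exact Fintype.card_congr (Equiv.sigmaFiberEquiv G.connectedComponentMk).symm
  rw [h1, h2, Finset.mul_sum, ← Finset.sum_congr rfl fun c _ => htree c, Finset.sum_add_distrib,
    Nat.card_eq_fintype_card]
  simp [mul_comm]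

namespace SoergelGraph

variable {S : Type*} {𝕜 : Type*} [CommRing 𝕜] {ι : Type*} {d : ℕ} {x : Fin d → S}

/-- The number of edge ends at a node. -/
def nodeValence (G : SoergelGraph 𝕜 ι x) (u : G.Node) : ℕ :=
  Nat.card {p : G.E × Bool // G.endpt p.1 p.2 = u}

theorem skeleton_adj_of_edge {G : SoergelGraph 𝕜 ι x} (hG : G.OnlyTrees) (e : G.E) (b : Bool) :
    G.skeleton.Adj (G.endpt e b) (G.endpt e !b) := by
  have h : G.skeleton.Adj (G.endpt e false) (G.endpt e true) :=
    ⟨hG.no_loop e, Or.inl ⟨e, rfl, rfl⟩⟩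
  cases b
  · exact h
  · exact h.symm

theorem exists_edge_of_skeleton_adj {G : SoergelGraph 𝕜 ι x} {u v : G.Node}
    (h : G.skeleton.Adj u v) : ∃ e b, G.endpt e b = u ∧ G.endpt e (!b) = v := by
  obtain ⟨-, ⟨e, h1, h2⟩ | ⟨e, h1, h2⟩⟩ := h
  · exact ⟨e, false, h1, h2⟩
  · exact ⟨e, true, h2, h1⟩

theorem card_neighborSet_skeleton {G : SoergelGraph 𝕜 ι x} (hG : G.OnlyTrees) (u : G.Node) :
    Nat.card (G.skeleton.neighborSet u) = G.nodeValence u := by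
  symm
  refine Nat.card_eq_of_bijective (f := fun p => ⟨G.endpt p.1.1 !p.1.2, ?_⟩) ⟨?_, ?_⟩
  · have := skeleton_adj_of_edge hG p.1.1 p.1.2
    rwa [p.2] at this
  · rintro ⟨⟨e, b⟩, h⟩ ⟨⟨e', b'⟩, h'⟩ hp
    replace hp := congrArg Subtype.val hp
    simp only at hp h h'
    have hs : ∀ e b, s(G.endpt e false, G.endpt e true) = s(G.endpt e b, G.endpt e !b) := by
      intro e b
      cases b
      · rfl
      · exact Sym2.eq_swap
    have he : e = e' := hG.no_multiple_edge (by
      simp only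
      rw [hs e b, hs e' b', h, h', hp])
    subst he
    have hb : b = b' := by
      have := hG.no_loop e
      cases b <;> cases b' <;> first | rfl | (exfalso; grind)
    subst hb
    rfl
  · rintro ⟨v, hv⟩
    obtain ⟨e, b, h1, h2⟩ := exists_edge_of_skeleton_adj hv
    exact ⟨⟨(e, b), h1⟩, Subtype.ext h2⟩

/-- A forest without polynomials has degree `2 #components - d`. -/
theorem degree_eq {G : SoergelGraph 𝕜 ι x} (hG : G.OnlyTrees) (hB : IsEmpty G.B) :
    G.degree = 2 * (Nat.card G.Component : ℤ) - d := by
  classical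
  have h1 := hG.acyclic.sum_card_neighborSet
  simp only [card_neighborSet_skeleton hG, Fintype.sum_sum_type, Fintype.card_sum,
    Fintype.card_fin] at h1
  have h2 : ∑ i : Fin d, G.nodeValence (Sum.inr i) = d := by
    rw [Finset.sum_congr rfl fun i _ => show G.nodeValence (Sum.inr i) = 1 from
      G.valence_boundary i]
    simp
  have h3 : ∀ v, G.nodeValence (Sum.inl v) =
      (if G.valence v = 1 then 1 else 0) + 3 * (if G.valence v = 3 then 1 else 0) := by
    intro v
    change G.valence v = _
    rcases G.valence_vertex v with h | h <;> (change G.valence v = _ at h; simp [h])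
  have h4 : ∀ v, 1 = (if G.valence v = 1 then 1 else 0) + (if G.valence v = 3 then 1 else 0) := by
    intro v
    rcases G.valence_vertex v with h | h <;> (change G.valence v = _ at h; simp [h])
  have h5 : Fintype.card G.V = ∑ v : G.V, 1 := by simp
  rw [Finset.sum_congr rfl fun v _ => h4 v, Finset.sum_add_distrib] at h5
  rw [Finset.sum_congr rfl fun v _ => h3 v, Finset.sum_add_distrib, ← Finset.mul_sum, h2] at h1
  have h6 : ∀ k, Nat.card {v : G.V // G.valence v = k} =
      ∑ v : G.V, if G.valence v = k then 1 else 0 := by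
    intro k
    rw [Nat.card_eq_fintype_card, Fintype.card_subtype, Finset.card_filter]
  unfold degree
  -- With `n₁` dots, `n₃` trivalent vertices and `c` components, `h1` reads `n₁ + 3n₃ + d + 2c =
  -- 2(n₁ + n₃ + d)`, so `n₁ - n₃ = 2c - d`.
  rw [Finset.univ_eq_empty, Finset.sum_empty, h6, h6]
  simp only [Component] at *
  omega

/-- The color is carried along a walk: edges meeting at a vertex share it, and at a boundary point
it is prescribed by `x`. -/
theorem edgeColor_eq_of_comp_eq {G : SoergelGraph 𝕜 ι x} {e : G.E} {b : Bool} {i : Fin d}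
    (h : G.comp (Sum.inr i) = G.comp (G.endpt e b)) : G.edgeColor e = x i := by
  have key : ∀ u v : G.Node, G.skeleton.Reachable u v →
      (∀ e b, G.endpt e b = u → G.edgeColor e = x i) →
      ∀ e b, G.endpt e b = v → G.edgeColor e = x i := by
    rintro u v ⟨p⟩
    induction p with
    | nil => exact id
    | @cons u v w hadj p ih =>
      intro hu
      refine ih fun e b he => ?_
      obtain ⟨e', b', h1, h2⟩ := exists_edge_of_skeleton_adj hadj
      rw [← hu e' b' h1]
      obtain v | j := v
      · exact G.color_vertex _ _ _ _ _ he h2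
      · rw [G.color_boundary _ _ _ he, G.color_boundary _ _ _ h2]
  exact key _ _ (SimpleGraph.ConnectedComponent.exact h)
    (fun e b he => G.color_boundary e b i he) e b rfl

theorem color_eq_of_comp_eq {G : SoergelGraph 𝕜 ι x} {i j : Fin d}
    (h : G.comp (Sum.inr i) = G.comp (Sum.inr j)) : x i = x j := by
  have hj := G.valence_boundary j
  obtain ⟨⟨⟨e, b⟩, he⟩⟩ := (Nat.card_pos_iff.1 (hj ▸ one_pos)).1
  rw [← edgeColor_eq_of_comp_eq (h.trans (congrArg G.comp he.symm)), G.color_boundary _ _ _ he]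

/-! ### Components do not cross -/

/-- The points of the disk which belong to a component of the graph. -/
def componentSet (G : SoergelGraph 𝕜 ι x) (c : G.Component) : Set ℂ :=
  {z | (∃ u, G.comp u = c ∧ nodePosition d G.vertexPt u = z) ∨
    ∃ e, G.comp (G.endpt e false) = c ∧ ∃ t ∈ Set.Ioo (0 : I) 1, G.arc e t = z}

/-- By `embedded`, a point of the graph comes from a unique node, interior edge point or circle
point, and that preimage determines the component. -/
theorem eq_of_mem_componentSet {G : SoergelGraph 𝕜 ι x} {c c' : G.Component} {z : ℂ}
    (h : z ∈ G.componentSet c) (h' : z ∈ G.componentSet c') : c = c' := by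
  have key : ∀ c, z ∈ G.componentSet c → ∃ y, Sum.elim (nodePosition d G.vertexPt)
      (Sum.elim (fun p : G.E × Set.Ioo (0 : I) 1 => G.arc p.1 p.2)
        (fun p : G.C × Circle => G.circ p.1 p.2)) y = z ∧
      Sum.elim (fun u => some (G.comp u)) (Sum.elim (fun p : G.E × Set.Ioo (0 : I) 1 =>
        some (G.comp (G.endpt p.1 false))) fun _ => none) y = some c := by
    rintro c (⟨u, hu, hz⟩ | ⟨e, he, t, ht, hz⟩)
    · exact ⟨Sum.inl u, hz, congrArg some hu⟩
    · exact ⟨Sum.inr (Sum.inl (e, ⟨t, ht⟩)), hz, congrArg some he⟩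
  obtain ⟨y, hy, hc⟩ := key c h
  obtain ⟨y', hy', hc'⟩ := key c' h'
  have := G.embedded (hy.trans hy'.symm)
  rw [this, hc'] at hc
  exact (Option.some.inj hc).symm

theorem componentSet_subset (G : SoergelGraph 𝕜 ι x) (c : G.Component) {z : ℂ}
    (hz : z ∈ G.componentSet c) : ‖z‖ ≤ 1 := by
  have hopen : ∀ {z}, z ∈ openDisk → ‖z‖ ≤ 1 := fun hz => (mem_ball_zero_iff.1 hz).le
  obtain ⟨u | i, -, rfl⟩ | ⟨e, -, t, ht, rfl⟩ := hz
  · exact hopen (G.vertexPt_mem u)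
  · have : (2 * Real.pi * Complex.I * ((i : ℕ) : ℂ) / (d : ℂ)) =
        ((2 * Real.pi * i / d : ℝ) : ℂ) * Complex.I := by push_cast; ring
    change ‖boundaryPt d i‖ ≤ 1
    rw [boundaryPt, this, Complex.norm_exp_ofReal_mul_I]
  · exact hopen (G.arc_mem e t ht)

theorem joinedIn_componentSet {G : SoergelGraph 𝕜 ι x} (hG : G.OnlyTrees) {u v : G.Node}
    (h : G.comp u = G.comp v) : JoinedIn (G.componentSet (G.comp u))
      (nodePosition d G.vertexPt u) (nodePosition d G.vertexPt v) := by
  have hedge : ∀ e, JoinedIn (G.componentSet (G.comp (G.endpt e false)))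
      (nodePosition d G.vertexPt (G.endpt e false))
      (nodePosition d G.vertexPt (G.endpt e true)) := by
    intro e
    refine ⟨G.arc e, fun t => ?_⟩
    rcases eq_or_ne t 0 with rfl | h0
    · exact Or.inl ⟨_, rfl, by simp⟩
    rcases eq_or_ne t 1 with rfl | h1
    · refine Or.inl ⟨G.endpt e true, ?_, by simp⟩
      exact SimpleGraph.ConnectedComponent.sound (skeleton_adj_of_edge hG e true).reachable
    · exact Or.inr ⟨e, rfl, t, ⟨unitInterval.pos_iff_ne_zero.2 h0,
        unitInterval.lt_one_iff_ne_one.2 h1⟩, rfl⟩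
  obtain ⟨p⟩ := SimpleGraph.ConnectedComponent.exact h
  induction p with
  | nil => exact JoinedIn.refl (Or.inl ⟨_, rfl, rfl⟩)
  | @cons u v w hadj p ih =>
    have huv : G.comp u = G.comp v := SimpleGraph.ConnectedComponent.sound hadj.reachable
    have hvw := ih (huv.symm.trans h)
    rw [← huv] at hvw
    refine JoinedIn.trans ?_ hvw
    obtain ⟨e, b, h1, h2⟩ := exists_edge_of_skeleton_adj hadj
    subst h1 h2
    have := hedge e
    cases b
    · exact this
    · rw [huv]
      exact this.symm

/-- Distinct components do not cross. -/
theorem comp_eq_of_interlaced {G : SoergelGraph 𝕜 ι x} (hG : G.OnlyTrees) {i k j l : Fin d}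
    (hik : i < k) (hkj : k < j) (hjl : j < l)
    (hij : G.comp (Sum.inr i) = G.comp (Sum.inr j))
    (hkl : G.comp (Sum.inr k) = G.comp (Sum.inr l)) :
    G.comp (Sum.inr i) = G.comp (Sum.inr k) := by
  have hd : (0 : ℝ) < d := by exact_mod_cast i.pos
  have hpos : ∀ i : Fin d, nodePosition d G.vertexPt (Sum.inr i) =
      Complex.exp ((2 * Real.pi * i / d : ℝ) * Complex.I) := by
    intro i
    change boundaryPt d i = _
    rw [boundaryPt]
    congr 1
    push_cast
    ring
  obtain ⟨γ, hγ⟩ := joinedIn_componentSet hG hij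
  obtain ⟨δ, hδ⟩ := joinedIn_componentSet hG hkl
  have hlt : ∀ {a b : Fin d}, a < b → 2 * Real.pi * a / d < 2 * Real.pi * b / d := by
    intro a b hab
    have : (a : ℝ) < b := by exact_mod_cast hab
    have := Real.pi_pos
    gcongr
  obtain ⟨s, t, hst⟩ := exists_eq_of_interlaced (hlt hik) (hlt hkj) (hlt hjl) (by
      have h1 : (l : ℝ) < d := by exact_mod_cast l.2
      have h2 : (0 : ℝ) ≤ 2 * Real.pi * i / d := by positivity
      have h3 : 2 * Real.pi * l / d < 2 * Real.pi := by
        rw [div_lt_iff₀ hd]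
        have := Real.pi_pos
        gcongr
      linarith) (γ.cast (hpos i).symm (hpos j).symm) (δ.cast (hpos k).symm (hpos l).symm)
    (fun t => G.componentSet_subset _ (hγ t)) (fun t => G.componentSet_subset _ (hδ t))
  have h1 := hγ s
  rw [show γ s = δ t from hst] at h1
  exact eq_of_mem_componentSet h1 (hδ t)

end SoergelGraph

/-! ### Noncrossing partitions and classes of gaps -/

/-- This is the duality of chords: the chord of the points `i`, `j` does not separate the gaps `g`,
`h` precisely when the chord of the gaps does not separate the points. -/
theorem iff_interchange {a b c e : Prop} (h : (a ↔ b) ↔ (c ↔ e)) : (a ↔ c) ↔ (b ↔ e) := by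
  by_cases a <;> by_cases b <;> by_cases c <;> by_cases e <;> simp_all

/-- Two gaps are equivalent when no block of the partition by the fibers of `π` separates them;
the gap `g` lies between the points `g` and `g + 1`. -/
def gapSetoid {K : Type*} {d : ℕ} (π : Fin d → K) : Setoid (Fin d) where
  r g h := ∀ i j, π i = π j → (((g < i) ↔ (g < j)) ↔ ((h < i) ↔ (h < j)))
  iseqv := ⟨fun _ _ _ _ => Iff.rfl, fun h i j hij => (h i j hij).symm,
    fun h h' i j hij => (h i j hij).trans (h' i j hij)⟩

/-- Distinct blocks of the partition by the fibers of `π` do not cross. -/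
def IsNoncrossing {K : Type*} {d : ℕ} (π : Fin d → K) : Prop :=
  ∀ i k j l : Fin d, i < k → k < j → j < l → π i = π j → π k = π l → π i = π k

theorem coe_finRotate_eq {d : ℕ} (g : Fin d) :
    (finRotate d g : ℕ) = if (g : ℕ) + 1 = d then 0 else (g : ℕ) + 1 := by
  obtain _ | n := d
  · exact g.elim0
  · rw [coe_finRotate]
    simp [Fin.ext_iff]

/-- The partition has many classes of gaps. -/
theorem card_add_card_gapClasses {K : Type*} [Finite K] {d : ℕ} (hd : 0 < d) (π : Fin d → K) :
    d + 1 ≤ Nat.card K + Nat.card (Quotient (gapSetoid π)) := by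
  classical
  -- The first points of the blocks, at most one for each element of `K`.
  let m : Finset (Fin d) := {i | ∀ b < i, π b ≠ π i}
  have hm : m.card ≤ Nat.card K := by
    have := Fintype.ofFinite K
    rw [Nat.card_eq_fintype_card]
    refine Finset.card_le_card_of_injOn π (fun _ _ => Finset.mem_univ _) ?_
    intro i hi j hj hij
    simp only [m, Finset.coe_filter, Finset.mem_univ, true_and, Set.mem_ofPred_eq] at hi hj
    by_contra hne
    rcases lt_or_gt_of_ne hne with h | h
    · exact hj i h hij
    · exact hi j h hij.symm
  have h0 : (⟨0, hd⟩ : Fin d) ∉ mᶜ := by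
    simp only [m, Finset.mem_compl, Finset.mem_filter, Finset.mem_univ, true_and, not_not]
    intro b hb
    exact absurd hb (by simp [Fin.lt_def])
  let A : Finset (Fin d) := insert ⟨0, hd⟩ mᶜ
  have hA : A.card = d - m.card + 1 := by
    rw [Finset.card_insert_of_notMem h0, Finset.card_compl, Fintype.card_fin]
  have hmd : m.card ≤ d := by simpa using m.card_le_univ
  have hAq : A.card ≤ Nat.card (Quotient (gapSetoid π)) := by
    rw [Nat.card_eq_fintype_card]
    refine Finset.card_le_card_of_injOn
      (fun i => Quotient.mk (gapSetoid π) ((finRotate d).symm i)) (fun _ _ => Finset.mem_univ _) ?_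
    -- For `i` with an earlier point `b` in its block, the chord from `b` to `i` spans the gap
    -- before `i` but not the gap before `j`. The gap before the point `0` is `d - 1`, spanned by no
    -- chord, whereas the gap before `j` is spanned by a chord ending at `j`.
    have key : ∀ i ∈ A, ∀ j ∈ A, i < j →
        ¬ (gapSetoid π).r ((finRotate d).symm i) ((finRotate d).symm j) := by
      intro i hi j hj hij hr
      have ei := coe_finRotate_eq ((finRotate d).symm i)
      have ej := coe_finRotate_eq ((finRotate d).symm j)
      rw [Equiv.apply_symm_apply] at ei ej
      set p := (finRotate d).symm i
      set q := (finRotate d).symm j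
      simp only [A, m, Finset.mem_insert, Finset.mem_compl, Finset.mem_filter, Finset.mem_univ,
        true_and, not_forall, not_not] at hi hj
      have hp := p.2
      have hq := q.2
      have hj' : ∃ b < j, π b = π j := by
        rcases hj with rfl | ⟨b, hb, h⟩
        · simp [Fin.lt_def] at hij
        · exact ⟨b, hb, h⟩
      rcases hi with rfl | ⟨b, hb, hπ⟩
      · obtain ⟨b, hb, hπ⟩ := hj'
        have := hr b j hπ
        have hb2 := b.2
        simp only [Fin.lt_def] at this hb hij ei
        split_ifs at ei ej <;> omega
      · have := hr b i hπ
        simp only [Fin.lt_def] at this hb hij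
        split_ifs at ei ej <;> omega
    intro i hi j hj hij
    have hr := Quotient.exact hij
    by_contra hne
    rcases lt_or_gt_of_ne hne with h | h
    · exact key i hi j hj h hr
    · exact key j hj i hi h ((gapSetoid π).symm hr)
  omega

/-- If `a` is the last point before `j` of a block which does not contain `j`, then
the gap after `a` is equivalent to the gap before the next point of that block. -/
theorem exists_gapSetoid_of_ne {K : Type*} {d : ℕ} {π : Fin d → K} (hπ : IsNoncrossing π)
    {a j : Fin d} (hne : π a ≠ π j)
    (ha : (a < j ∧ ∀ b, π b = π a → b < j → b ≤ a) ∨ ∀ b, π b = π a → j < b ∧ b ≤ a) :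
    ∃ h, (gapSetoid π).r a h ∧ ¬ (((a < a) ↔ (h < a)) ↔ ((a < j) ↔ (h < j))) := by
  classical
  -- If the block has points on both sides of `j`, its next point `a'` is the first one after `j`.
  -- Otherwise `a` is its maximum, and the cyclically next point is its minimum.
  by_cases hgt : a < j ∧ ∃ b, π b = π a ∧ j < b
  · obtain ⟨haj, b, hb, hjb⟩ := hgt
    replace ha : ∀ b, π b = π a → b < j → b ≤ a := by
      rcases ha with ha | ha
      · exact ha.2
      · exact absurd (ha a rfl).1 haj.asymm
    obtain ⟨a', ⟨ha', hja'⟩, hmin⟩ : ∃ a', (π a' = π a ∧ j < a') ∧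
        ∀ b, π b = π a ∧ j < b → a' ≤ b := by
      have hne : (Finset.univ.filter fun b => π b = π a ∧ j < b).Nonempty := ⟨b, by simp [hb, hjb]⟩
      refine ⟨Finset.min' _ hne, ?_, fun b hb => Finset.min'_le _ _ (by simpa using hb)⟩
      simpa using Finset.min'_mem _ hne
    have h0 : (a' : ℕ) - 1 < d := by omega
    refine ⟨⟨a' - 1, h0⟩, ?_, ?_⟩
    -- By noncrossing, a block with a point strictly between `a` and `a'` stays there, so no chord
    -- separates the first and last gap of this interval.
    · have key : ∀ i k, π i = π k → i ≤ a ∨ a' ≤ i ∨ (a < k ∧ k < a') := by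
        intro i k hik
        by_contra! hcon
        obtain ⟨h1, h2, h3⟩ := hcon
        replace h3 : k ≤ a ∨ a' ≤ k := (le_or_gt k a).imp id h3
        have hia : π i ≠ π a := by
          intro hia
          rcases lt_trichotomy i j with h | h | h
          · exact absurd (ha i hia h) (not_le.2 h1)
          · exact hne (h ▸ hia.symm)
          · exact absurd (hmin i ⟨hia, h⟩) (not_le.2 h2)
        rcases h3 with h3 | h3
        · rcases h3.lt_or_eq with h4 | rfl
          · exact hia (hik.trans (hπ k a i a' h4 h1 h2 hik.symm ha'.symm))
          · exact hia hik
        · rcases h3.lt_or_eq with h4 | rfl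
          · exact hia (hπ a i a' k h1 h2 h4 ha'.symm hik).symm
          · exact hia (hik.trans ha')
      intro i k hik
      have k1 := key i k hik
      have k2 := key k i hik.symm
      simp only [Fin.lt_def, Fin.le_def] at hja' k1 k2 ⊢
      omega
    · simp only [Fin.lt_def] at *
      omega
  · have hmax : ∀ b, π b = π a → b ≤ a := by
      intro b hb
      rcases ha with ha | ha
      · refine ha.2 b hb (lt_of_le_of_ne (not_lt.1 fun h => hgt ⟨ha.1, b, hb, h⟩) ?_)
        rintro rfl
        exact hne hb.symm
      · exact (ha b hb).2
    obtain ⟨a', ha', hmin⟩ : ∃ a', π a' = π a ∧ ∀ b, π b = π a → a' ≤ b := by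
      have hne : (Finset.univ.filter fun b => π b = π a).Nonempty := ⟨a, by simp⟩
      refine ⟨Finset.min' _ hne, ?_, fun b hb => Finset.min'_le _ _ (by simpa using hb)⟩
      simpa using Finset.min'_mem _ hne
    have hja : j < a' ∨ a < j := by
      rcases ha with ha | ha
      · exact Or.inr ha.1
      · exact Or.inl (ha a' ha').1
    -- Likewise a block with a point in `[a', a]` stays inside this interval.
    have key : ∀ i k, π i = π k → i < a' ∨ a < i ∨ (a' ≤ k ∧ k ≤ a) := by
      intro i k hik
      by_contra! hcon
      obtain ⟨h1, h2, h3⟩ := hcon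
      replace h3 : k < a' ∨ a < k := (lt_or_ge k a').imp id h3
      have hia : π i ≠ π a := by
        intro hia
        rcases h3 with h3 | h3
        · exact absurd (hmin k (hik.symm.trans hia)) (not_le.2 h3)
        · exact absurd (hmax k (hik.symm.trans hia)) (not_le.2 h3)
      have h1' : a' < i := lt_of_le_of_ne h1 (by rintro rfl; exact hia ha')
      have h2' : i < a := lt_of_le_of_ne h2 (by rintro rfl; exact hia rfl)
      rcases h3 with h3 | h3
      · exact hia (hik.trans (hπ k a' i a h3 h1' h2' hik.symm ha' |>.trans ha'))
      · exact hia ((hπ a' i a k h1' h2' h3 ha' hik).symm.trans ha')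
    have haa : a' ≤ a := hmax a' ha'
    -- The gap before `a'` is `a' - 1`, except that the gap before the point `0` is `d - 1`.
    by_cases h0 : (a' : ℕ) = 0
    · refine ⟨⟨d - 1, by have := a.2; omega⟩, ?_, ?_⟩
      · intro i k hik
        have k1 := key i k hik
        have k2 := key k i hik.symm
        have := i.2
        have := k.2
        simp only [Fin.lt_def, Fin.le_def] at k1 k2 ⊢
        omega
      · have := j.2
        have := a.2
        simp only [Fin.lt_def, Fin.le_def] at *
        omega
    · refine ⟨⟨a' - 1, by omega⟩, ?_, ?_⟩
      · intro i k hik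
        have k1 := key i k hik
        have k2 := key k i hik.symm
        simp only [Fin.lt_def, Fin.le_def] at k1 k2 ⊢
        omega
      · simp only [Fin.lt_def, Fin.le_def] at *
        omega

/-- Points in distinct blocks are separated by a pair of equivalent gaps. -/
theorem exists_gapSetoid_separating {K : Type*} {d : ℕ} {π : Fin d → K} (hπ : IsNoncrossing π)
    {i j : Fin d} (hne : π i ≠ π j) :
    ∃ g h, (gapSetoid π).r g h ∧ ¬ (((g < i) ↔ (h < i)) ↔ ((g < j) ↔ (h < j))) := by
  classical
  have haux : ∀ P : Fin d → Prop, (∃ b, P b) → ∃ a, P a ∧ ∀ b, P b → b ≤ a := by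
    rintro P ⟨b, hb⟩
    have hne : (Finset.univ.filter P).Nonempty := ⟨b, by simp [hb]⟩
    refine ⟨Finset.max' _ hne, ?_, fun b hb => Finset.le_max' _ _ (by simpa using hb)⟩
    simpa using Finset.max'_mem _ hne
  obtain ⟨a, hai, ha⟩ : ∃ a, π a = π i ∧
      ((a < j ∧ ∀ b, π b = π a → b < j → b ≤ a) ∨ ∀ b, π b = π a → j < b ∧ b ≤ a) := by
    by_cases hlt : ∃ b, π b = π i ∧ b < j
    · obtain ⟨a, ⟨h1, h2⟩, h3⟩ := haux _ hlt
      exact ⟨a, h1, Or.inl ⟨h2, fun b hb hbj => h3 b ⟨hb.trans h1, hbj⟩⟩⟩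
    · obtain ⟨a, h1, h3⟩ := haux (fun b => π b = π i) ⟨i, rfl⟩
      refine ⟨a, h1, Or.inr fun b hb => ⟨lt_of_le_of_ne (not_lt.1 fun h => hlt ⟨b, hb.trans h1, h⟩)
        ?_, h3 b (hb.trans h1)⟩⟩
      rintro rfl
      exact hne (hb.trans h1).symm
  obtain ⟨h, hr, hs⟩ := exists_gapSetoid_of_ne hπ (hai ▸ hne) ha
  -- The points `i` and `a` share a block, so the chord of the equivalent gaps `a`, `h` does not
  -- separate them; as it separates `a` from `j`, it separates `i` from `j`.
  exact ⟨a, h, hr, fun hiff => hs ((iff_interchange (hr a i hai)).trans hiff)⟩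

/-- A gap between distinct blocks is equivalent to another gap. -/
theorem exists_ne_gapSetoid {K : Type*} {d : ℕ} {π : Fin d → K} (hπ : IsNoncrossing π)
    {g : Fin d} (hne : π g ≠ π (finRotate d g)) : ∃ h, h ≠ g ∧ (gapSetoid π).r g h := by
  have e := coe_finRotate_eq g
  -- The point `g` is the last of its block before the next point `g + 1`. When that wraps around to
  -- `0`, the second alternative applies.
  obtain ⟨h, hr, hs⟩ := exists_gapSetoid_of_ne hπ hne (by
    by_cases hg : (g : ℕ) + 1 = d
    · right
      intro b hb
      have h2 : b ≠ finRotate d g := by rintro rfl; exact hne hb.symm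
      rw [if_pos hg] at e
      have := b.2
      simp only [Fin.lt_def, Fin.le_def, ne_eq, Fin.ext_iff] at *
      omega
    · left
      rw [if_neg hg] at e
      refine ⟨?_, fun b _ hb => ?_⟩ <;>
      · simp only [Fin.lt_def, Fin.le_def] at *
        omega)
  refine ⟨h, ?_, hr⟩
  rintro rfl
  exact hs (by simp)

/-- The number of gaps at which `x` changes is bounded in terms of the number of blocks, and in
the extremal case without repetitions the gaps are paired. -/
theorem two_mul_card_sub_le {K S : Type*} [Finite K] {d : ℕ} (hd : 0 < d) {π : Fin d → K}
    (hπ : IsNoncrossing π) {x : Fin d → S} (hx : ∀ i j, π i = π j → x i = x j) :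
    d + 2 ≤ 2 * Nat.card K + repetitions x ∧
      (repetitions x = 0 → 2 * Nat.card K = d + 2 →
        ∀ g, ∃ h, h ≠ g ∧ ∀ k, (gapSetoid π).r g k ↔ k = g ∨ k = h) := by
  classical
  let q : Fin d → Quotient (gapSetoid π) := Quotient.mk _
  let cls : Quotient (gapSetoid π) → Finset (Fin d) := fun c => {g | q g = c}
  let chg : Finset (Fin d) := {g | x g ≠ x (finRotate d g)}
  have hrep : chg.card + repetitions x = d := by
    rw [repetitions, Nat.card_eq_fintype_card, Fintype.card_subtype, add_comm]
    exact (Finset.card_filter_add_card_filter_not (s := (Finset.univ : Finset (Fin d)))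
      (fun g => x g = x (finRotate d g))).trans (Finset.card_fin d)
  have hpos : ∀ c, 1 ≤ (cls c).card := by
    intro c
    obtain ⟨g, rfl⟩ := Quotient.exists_rep c
    exact Finset.card_pos.2 ⟨g, by simp [cls, q]⟩
  -- For a class of `n ≥ 2` gaps, `n ≤ 2(n - 1)`. The gap of a singleton class lies between points
  -- of one block, so the color does not change there.
  have hle : ∀ c, (chg.filter fun g => q g = c).card ≤ 2 * ((cls c).card - 1) := by
    intro c
    have hsub : (chg.filter fun g => q g = c) ⊆ cls c := by
      intro g hg
      simp only [Finset.mem_filter] at hg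
      simp [cls, hg.2]
    rcases (hpos c).eq_or_lt with h1 | h1
    · have : (chg.filter fun g => q g = c) = ∅ := by
        refine Finset.eq_empty_of_forall_notMem fun g hg => ?_
        have hgc := hsub hg
        simp only [chg, Finset.mem_filter, Finset.mem_univ, true_and] at hg
        obtain ⟨h, hne, hr⟩ := exists_ne_gapSetoid hπ (g := g) fun h => hg.1 (hx _ _ h)
        have hhc : h ∈ cls c := by
          simp only [cls, Finset.mem_filter, Finset.mem_univ, true_and]
          rw [← hg.2]
          exact (Quotient.sound hr).symm
        exact hne (Finset.card_le_one.1 h1.ge _ hhc _ hgc)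
      simp [this]
    · have := Finset.card_le_card hsub
      omega
  have hsum1 : chg.card = ∑ c, (chg.filter fun g => q g = c).card :=
    Finset.card_eq_sum_card_fiberwise fun _ _ => Finset.mem_univ _
  have hsum2 : d = ∑ c, (cls c).card := by
    have := Finset.card_eq_sum_card_fiberwise (s := Finset.univ) (t := Finset.univ) (f := q)
      fun _ _ => Finset.mem_univ _
    rwa [Finset.card_univ, Fintype.card_fin] at this
  have hsum3 : ∑ c, 2 * ((cls c).card - 1) + 2 * Nat.card (Quotient (gapSetoid π)) = 2 * d := by
    have h1 : ∑ c : Quotient (gapSetoid π), 1 = Nat.card (Quotient (gapSetoid π)) := by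
      rw [Nat.card_eq_fintype_card]; simp
    rw [← h1, ← Finset.mul_sum, ← mul_add, ← Finset.sum_add_distrib,
      Finset.sum_congr rfl fun c _ => Nat.sub_add_cancel (hpos c), ← hsum2]
  have hcard := card_add_card_gapClasses hd π
  have hineq := Finset.sum_le_sum fun c (_ : c ∈ Finset.univ) => hle c
  rw [← hsum1] at hineq
  refine ⟨by omega, fun h0 hK g => ?_⟩
  -- All inequalities are now equalities, class by class, and every gap is a color change; so each
  -- class has `n = 2(n - 1)`.
  have heq : ∑ c, (chg.filter fun g => q g = c).card = ∑ c, 2 * ((cls c).card - 1) := by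
    rw [← hsum1]; omega
  have heq' := (Finset.sum_eq_sum_iff_of_le fun c _ => hle c).1 heq (q g) (Finset.mem_univ _)
  have hchg : chg = Finset.univ := by
    rw [← Finset.card_eq_iff_eq_univ, Fintype.card_fin]; omega
  rw [hchg] at heq'
  change (cls (q g)).card = _ at heq'
  have h2 : (cls (q g)).card = 2 := by
    have := hpos (q g)
    omega
  have hmem : ∀ k, k ∈ cls (q g) ↔ (gapSetoid π).r g k := by
    intro k
    simp only [cls, Finset.mem_filter, Finset.mem_univ, true_and]
    exact ⟨fun h => (gapSetoid π).symm (Quotient.exact h), fun h => (Quotient.sound h).symm⟩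
  obtain ⟨h, hne, hr⟩ : ∃ h, h ≠ g ∧ (gapSetoid π).r g h := by
    obtain ⟨h, hh, hne⟩ := Finset.exists_mem_ne (s := cls (q g)) (by omega) g
    exact ⟨h, hne, (hmem h).1 hh⟩
  refine ⟨h, hne, fun k => ⟨fun hk => ?_, ?_⟩⟩
  · by_contra! hk'
    have : ({g, h, k} : Finset (Fin d)) ⊆ cls (q g) := by
      intro y hy
      rw [hmem]
      simp only [Finset.mem_insert, Finset.mem_singleton] at hy
      rcases hy with rfl | rfl | rfl
      · exact (gapSetoid π).refl _
      · exact hr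
      · exact hk
    have := Finset.card_le_card this
    rw [Finset.card_eq_three.2 ⟨g, h, k, hne.symm, hk'.1.symm, hk'.2.symm, rfl⟩] at this
    omega
  · rintro (rfl | rfl)
    · exact (gapSetoid π).refl _
    · exact hr

/-- Pairs of equivalent gaps from distinct classes do not cross. -/
theorem gapSetoid_noncrossing {K : Type*} {d : ℕ} {π : Fin d → K} {g g' h h' : Fin d}
    (hgh : (gapSetoid π).r g h) (hgh' : (gapSetoid π).r g' h') (h1 : g < g') (h2 : g' < h)
    (h3 : h < h') : (gapSetoid π).r g g' := by
  -- The gaps spanned by a chord form an interval. Since `g < g' < h < h'`, it contains `g` and `h`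
  -- exactly when it contains `g'` and `h'`.
  intro i j hij
  have e1 := hgh i j hij
  have e2 := hgh' i j hij
  simp only [Fin.lt_def] at *
  omega

/-! ### Convex sets cut along lines -/

theorem mul_pos_trans {a b c : ℝ} (h : 0 < a * b) (h' : 0 < b * c) : 0 < a * c := by
  rcases mul_pos_iff.1 h with ⟨h1, h2⟩ | ⟨h1, h2⟩
  · exact mul_pos h1 (pos_of_mul_pos_right h' h2.le)
  · exact mul_pos_of_neg_of_neg h1 (neg_of_mul_pos_right h' h2.le)

theorem mul_pos_of_isPreconnected {s : Set ℂ} (hs : IsPreconnected s) {f : ℂ → ℝ}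
    (hf : Continuous f) (h0 : ∀ z ∈ s, f z ≠ 0) {z w : ℂ} (hz : z ∈ s) (hw : w ∈ s) :
    0 < f z * f w := by
  have key : ∀ {z w}, z ∈ s → w ∈ s → f z ≤ 0 → 0 ≤ f w → False := by
    intro z w hz hw h1 h2
    obtain ⟨y, hy, hy0⟩ := hs.intermediate_value hz hw hf.continuousOn ⟨h1, h2⟩
    exact h0 y hy hy0
  rcases lt_or_gt_of_ne (h0 z hz) with h1 | h1 <;> rcases lt_or_gt_of_ne (h0 w hw) with h2 | h2
  · exact mul_pos_of_neg_of_neg h1 h2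
  · exact (key hz hw h1.le h2.le).elim
  · exact (key hw hz h2.le h1.le).elim
  · exact mul_pos h1 h2

/-- The components of a convex set cut along finitely many lines are the convex pieces. -/
theorem connectedComponentIn_eq_of_affine {A : Type*} {D : Set ℂ} (hD : Convex ℝ D)
    {f : A → ℂ →ᵃ[ℝ] ℝ} {z : ℂ} (hz : z ∈ D) (hz0 : ∀ a, f a z ≠ 0) :
    connectedComponentIn (D \ ⋃ a, {w ∈ D | f a w = 0}) z = {w ∈ D | ∀ a, 0 < f a z * f a w} := by
  have hzm : z ∈ D \ ⋃ a, {w ∈ D | f a w = 0} := ⟨hz, by simp [hz0]⟩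
  refine Set.Subset.antisymm (fun w hw => ⟨(connectedComponentIn_subset _ _ hw).1, fun a => ?_⟩)
    (IsPreconnected.subset_connectedComponentIn (Convex.isPreconnected ?_)
      ⟨hz, fun a => mul_self_pos.2 (hz0 a)⟩ ?_)
  · refine mul_pos_of_isPreconnected isPreconnected_connectedComponentIn
      (f a).continuous_of_finiteDimensional (fun y hy => ?_) (mem_connectedComponentIn hzm) hw
    intro h0
    have := connectedComponentIn_subset _ _ hy
    exact this.2 (Set.mem_iUnion.2 ⟨a, this.1, h0⟩)
  · have : {w ∈ D | ∀ a, 0 < f a z * f a w} = D ∩ ⋂ a, f a ⁻¹' {y | 0 < f a z * y} := by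
      ext w; simp
    rw [this]
    refine hD.inter (convex_iInter fun a => Convex.affine_preimage _ ?_)
    exact convex_halfSpace_gt (IsLinearMap.isLinearMap_smul (f a z)) 0
  · rintro w ⟨hw, hpos⟩
    refine ⟨hw, fun h => ?_⟩
    obtain ⟨a, -, ha⟩ := Set.mem_iUnion.1 h
    have := hpos a
    rw [ha, mul_zero] at this
    exact this.false

/-- From a point of a convex set cut along disjoint chords, the nearest chord is visible. -/
theorem exists_visible_chord {A : Type*} [Finite A] [Nonempty A] {D : Set ℂ} (hD : Convex ℝ D)
    (hDc : IsCompact D) {f : A → ℂ →ᵃ[ℝ] ℝ} (hne : ∀ a, ∃ w ∈ D, f a w = 0)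
    (hdisj : ∀ a b, a ≠ b → ∀ w ∈ D, f a w = 0 → f b w ≠ 0) {z : ℂ} (hz : z ∈ D) :
    ∃ a, ∃ w ∈ D, f a w = 0 ∧ ∀ b, b ≠ a → 0 < f b z * f b w := by
  have hcpt : IsCompact (⋃ a, {w ∈ D | f a w = 0}) :=
    isCompact_iUnion fun a => hDc.inter_right
      (isClosed_singleton.preimage (f a).continuous_of_finiteDimensional)
  have hnonempty : (⋃ a, {w ∈ D | f a w = 0}).Nonempty := by
    obtain ⟨w, hw⟩ := hne (Classical.arbitrary A)
    exact ⟨w, Set.mem_iUnion.2 ⟨_, hw⟩⟩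
  obtain ⟨w, hw, hmin⟩ := hcpt.exists_infDist_eq_dist hnonempty z
  obtain ⟨a, hwD, haw⟩ := Set.mem_iUnion.1 hw
  refine ⟨a, w, hwD, haw, fun b hb => ?_⟩
  refine mul_pos_of_isPreconnected (convex_segment z w).isPreconnected
    (f b).continuous_of_finiteDimensional ?_ (left_mem_segment ℝ z w) (right_mem_segment ℝ z w)
  -- A zero of `f b` on the segment from `z` to the nearest point `w` would be at least as far from
  -- `z`, hence equal to `w`, against disjointness.
  intro y hy hy0
  have hyD : y ∈ D := hD.segment_subset hz hwD hy
  have h1 : Metric.infDist z (⋃ a, {w ∈ D | f a w = 0}) ≤ dist z y :=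
    Metric.infDist_le_dist_of_mem (Set.mem_iUnion.2 ⟨b, hyD, hy0⟩)
  have h2 := dist_add_dist_of_mem_segment hy
  rw [hmin] at h1
  have h3 : y = w := dist_le_zero.1 (by linarith)
  exact hdisj b a hb y hyD hy0 (h3 ▸ haw)

/-! ### Chords of the unit circle -/

/-- The affine function which vanishes on the chord of the unit circle between the angles `α` and
`β`, and is positive on the points with angle between `α` and `β`. -/
def chordMap (α β : ℝ) : ℂ →ᵃ[ℝ] ℝ :=
  (Complex.reLm ∘ₗ LinearMap.mulLeft ℝ (Complex.exp ((-((α + β) / 2) : ℝ) * Complex.I))).toAffineMap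
    - AffineMap.const ℝ ℂ (Real.cos ((β - α) / 2))

theorem chordMap_apply (α β : ℝ) (z : ℂ) : chordMap α β z =
    (Complex.exp ((-((α + β) / 2) : ℝ) * Complex.I) * z).re - Real.cos ((β - α) / 2) := rfl

/-- Writing the difference of cosines as a product makes the sign depend only on the order of the
angles. -/
theorem chordMap_exp (α β θ : ℝ) : chordMap α β (Complex.exp (θ * Complex.I)) =
    2 * Real.sin ((θ - α) / 2) * Real.sin ((β - θ) / 2) := by
  rw [chordMap_apply, ← Complex.exp_add, ← add_mul, ← Complex.ofReal_add,
    Complex.exp_ofReal_mul_I_re, Real.cos_sub_cos]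
  have e1 : (-((α + β) / 2) + θ + (β - α) / 2) / 2 = (θ - α) / 2 := by ring
  have e2 : (-((α + β) / 2) + θ - (β - α) / 2) / 2 = -((β - θ) / 2) := by ring
  rw [e1, e2, Real.sin_neg]
  ring

theorem segment_eq_chord {α β : ℝ} (h : α < β) (h' : β < α + 2 * Real.pi) :
    segment ℝ (Complex.exp (α * Complex.I)) (Complex.exp (β * Complex.I)) =
      {w ∈ closedDisk | chordMap α β w = 0} := by
  have hnorm : ∀ θ : ℝ, Complex.exp (θ * Complex.I) ∈ closedDisk := fun θ => by
    rw [closedDisk, mem_closedBall_zero_iff, Complex.norm_exp_ofReal_mul_I]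
  refine Set.Subset.antisymm (fun w hw => ⟨(convex_closedBall _ _).segment_subset (hnorm α)
    (hnorm β) hw, ?_⟩) ?_
  · have hc : Convex ℝ (chordMap α β ⁻¹' {0}) := (convex_singleton 0).affine_preimage _
    exact hc.segment_subset (by simp [chordMap_exp]) (by simp [chordMap_exp]) hw
  · rintro w ⟨hw, hw0⟩
    rw [chordMap_apply, sub_eq_zero] at hw0
    set s := Real.sin ((β - α) / 2) with hs
    have hspos : 0 < s := Real.sin_pos_of_pos_of_lt_pi (by linarith) (by linarith)
    -- Rotating the middle of the arc to `1` makes the chord vertical, with ends at height `∓s`. The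
    -- height of `w'` then gives the convex coefficients.
    set w' := Complex.exp ((-((α + β) / 2) : ℝ) * Complex.I) * w with hw'
    have hn : w'.re * w'.re + w'.im * w'.im ≤ 1 := by
      rw [← Complex.normSq_apply, ← Complex.sq_norm, hw', norm_mul, Complex.norm_exp_ofReal_mul_I,
        one_mul]
      have := mem_closedBall_zero_iff.1 hw
      nlinarith [norm_nonneg w]
    have hcs := Real.sin_sq_add_cos_sq ((β - α) / 2)
    have him : |w'.im| ≤ s := by
      refine abs_le_of_sq_le_sq ?_ hspos.le
      rw [hw0] at hn
      rw [← hs] at hcs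
      nlinarith
    obtain ⟨hl, hr⟩ := abs_le.1 him
    have hww : w = Complex.exp (((α + β) / 2 : ℝ) * Complex.I) * w' := by
      rw [hw', ← mul_assoc, ← Complex.exp_add]
      simp
    have hA : Complex.exp (α * Complex.I) = Complex.exp (((α + β) / 2 : ℝ) * Complex.I) *
        Complex.exp ((-((β - α) / 2) : ℝ) * Complex.I) := by
      rw [← Complex.exp_add]
      congr 1
      push_cast
      ring
    have hB : Complex.exp (β * Complex.I) = Complex.exp (((α + β) / 2 : ℝ) * Complex.I) *
        Complex.exp (((β - α) / 2 : ℝ) * Complex.I) := by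
      rw [← Complex.exp_add]
      congr 1
      push_cast
      ring
    refine ⟨(s - w'.im) / (2 * s), (s + w'.im) / (2 * s), div_nonneg (by linarith) (by linarith),
      div_nonneg (by linarith) (by linarith), by field_simp; ring, ?_⟩
    rw [hww, hA, hB, ← mul_smul_comm, ← mul_smul_comm, ← mul_add]
    congr 1
    apply Complex.ext
    · simp only [Complex.add_re, Complex.smul_re, Complex.exp_ofReal_mul_I_re, Real.cos_neg, hw0,
        smul_eq_mul]
      field_simp
      ring
    · simp only [Complex.add_im, Complex.smul_im, Complex.exp_ofReal_mul_I_im, Real.sin_neg,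
        smul_eq_mul, ← hs]
      field_simp
      ring

theorem chordMap_exp_pos {α β θ : ℝ} (h1 : α < θ) (h2 : θ < β) (h3 : β < α + 2 * Real.pi) :
    0 < chordMap α β (Complex.exp (θ * Complex.I)) := by
  rw [chordMap_exp]
  have := Real.sin_pos_of_pos_of_lt_pi (x := (θ - α) / 2) (by linarith) (by linarith)
  have := Real.sin_pos_of_pos_of_lt_pi (x := (β - θ) / 2) (by linarith) (by linarith)
  positivity

theorem chordMap_exp_neg_of_lt {α β θ : ℝ} (h1 : θ < α) (h2 : α < β) (h3 : β < θ + 2 * Real.pi) :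
    chordMap α β (Complex.exp (θ * Complex.I)) < 0 := by
  rw [chordMap_exp]
  have h4 := Real.sin_neg_of_neg_of_neg_pi_lt (x := (θ - α) / 2) (by linarith) (by linarith)
  have h5 := Real.sin_pos_of_pos_of_lt_pi (x := (β - θ) / 2) (by linarith) (by linarith)
  nlinarith

theorem chordMap_exp_neg_of_gt {α β θ : ℝ} (h1 : α < β) (h2 : β < θ) (h3 : θ < α + 2 * Real.pi) :
    chordMap α β (Complex.exp (θ * Complex.I)) < 0 := by
  rw [chordMap_exp]
  have h4 := Real.sin_neg_of_neg_of_neg_pi_lt (x := (β - θ) / 2) (by linarith) (by linarith)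
  have h5 := Real.sin_pos_of_pos_of_lt_pi (x := (θ - α) / 2) (by linarith) (by linarith)
  nlinarith

/-! ### Chords between gaps -/

/-- The angle of `gapPt d g`. -/
def gapAngle (d : ℕ) (g : Fin d) : ℝ := Real.pi / d * (2 * g + 1)

/-- The angle of `boundaryPt d i`. -/
def boundaryAngle (d : ℕ) (i : Fin d) : ℝ := Real.pi / d * (2 * i)

theorem gapPt_eq {d : ℕ} (g : Fin d) : gapPt d g = Complex.exp (gapAngle d g * Complex.I) := by
  rw [gapPt, gapAngle]
  congr 1
  push_cast
  ring

theorem boundaryPt_eq {d : ℕ} (i : Fin d) :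
    boundaryPt d i = Complex.exp (boundaryAngle d i * Complex.I) := by
  rw [boundaryPt, boundaryAngle]
  congr 1
  push_cast
  ring

theorem gapPt_mem {d : ℕ} (g : Fin d) : gapPt d g ∈ closedDisk := by
  rw [closedDisk, mem_closedBall_zero_iff, gapPt_eq, Complex.norm_exp_ofReal_mul_I]

theorem boundaryPt_mem {d : ℕ} (i : Fin d) : boundaryPt d i ∈ closedDisk := by
  rw [closedDisk, mem_closedBall_zero_iff, boundaryPt_eq, Complex.norm_exp_ofReal_mul_I]

/-- Angles of gaps and boundary points are odd and even multiples of `π / d`, so comparisons of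
angles reduce to natural number arithmetic. -/
theorem pi_div_mul_lt {d : ℕ} (hd : 0 < d) {m n : ℕ} (h : m < n) :
    Real.pi / d * m < Real.pi / d * n := by
  have : (0 : ℝ) < d := by exact_mod_cast hd
  have := Real.pi_pos
  have : (m : ℝ) < n := by exact_mod_cast h
  gcongr

theorem pi_div_mul_lt_add {d : ℕ} (hd : 0 < d) {m n : ℕ} (h : m < n + 2 * d) :
    Real.pi / d * m < Real.pi / d * n + 2 * Real.pi := by
  have h1 := pi_div_mul_lt hd h
  have h2 : (d : ℝ) ≠ 0 := by exact_mod_cast hd.ne'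
  push_cast at h1
  have : Real.pi / d * (n + 2 * d) = Real.pi / d * n + 2 * Real.pi := by field_simp
  linarith

theorem gapAngle_eq_cast {d : ℕ} (g : Fin d) :
    gapAngle d g = Real.pi / d * ((2 * (g : ℕ) + 1 : ℕ) : ℝ) := by
  rw [gapAngle]; push_cast; ring

theorem boundaryAngle_eq_cast {d : ℕ} (i : Fin d) :
    boundaryAngle d i = Real.pi / d * ((2 * (i : ℕ) : ℕ) : ℝ) := by
  rw [boundaryAngle]; push_cast; ring

/-- The affine function which vanishes on the chord between two gaps. -/
def gapChord (d : ℕ) (g h : Fin d) : ℂ →ᵃ[ℝ] ℝ := chordMap (gapAngle d g) (gapAngle d h)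

theorem gapChord_left {d : ℕ} (g h : Fin d) : gapChord d g h (gapPt d g) = 0 := by
  rw [gapChord, gapPt_eq, chordMap_exp]; simp

theorem segment_gapPt {d : ℕ} {g h : Fin d} (hgh : g < h) :
    segment ℝ (gapPt d g) (gapPt d h) = {w ∈ closedDisk | gapChord d g h w = 0} := by
  rw [gapPt_eq, gapPt_eq, gapChord]
  rw [gapAngle_eq_cast, gapAngle_eq_cast]
  have hh := h.2
  rw [Fin.lt_def] at hgh
  exact segment_eq_chord (pi_div_mul_lt g.pos (by omega)) (pi_div_mul_lt_add g.pos (by omega))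

/-- For `g < h` the condition `hi` amounts to `g < i ≤ h`, which places the point on the arc from
gap `g` to gap `h`. -/
theorem gapChord_boundaryPt_pos {d : ℕ} {g h i : Fin d} (hgh : g < h)
    (hi : ¬ ((g < i) ↔ (h < i))) : 0 < gapChord d g h (boundaryPt d i) := by
  rw [boundaryPt_eq, gapChord, gapAngle_eq_cast, gapAngle_eq_cast, boundaryAngle_eq_cast]
  have hh := h.2
  simp only [Fin.lt_def] at hgh hi
  exact chordMap_exp_pos (pi_div_mul_lt g.pos (by omega)) (pi_div_mul_lt g.pos (by omega))
    (pi_div_mul_lt_add g.pos (by omega))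

theorem gapChord_boundaryPt_neg {d : ℕ} {g h i : Fin d} (hgh : g < h)
    (hi : (g < i) ↔ (h < i)) : gapChord d g h (boundaryPt d i) < 0 := by
  rw [boundaryPt_eq, gapChord, gapAngle_eq_cast, gapAngle_eq_cast, boundaryAngle_eq_cast]
  have hh := h.2
  have hi2 := i.2
  simp only [Fin.lt_def] at hgh hi
  rcases le_or_gt (i : ℕ) g with h1 | h1
  · exact chordMap_exp_neg_of_lt (pi_div_mul_lt g.pos (by omega)) (pi_div_mul_lt g.pos (by omega))
      (pi_div_mul_lt_add g.pos (by omega))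
  · exact chordMap_exp_neg_of_gt (pi_div_mul_lt g.pos (by omega)) (pi_div_mul_lt g.pos (by omega))
      (pi_div_mul_lt_add g.pos (by omega))

theorem gapChord_gapPt_pos {d : ℕ} {g h k : Fin d} (h1 : g < k) (h2 : k < h) :
    0 < gapChord d g h (gapPt d k) := by
  rw [gapPt_eq, gapChord, gapAngle_eq_cast, gapAngle_eq_cast, gapAngle_eq_cast]
  have hh := h.2
  simp only [Fin.lt_def] at h1 h2
  exact chordMap_exp_pos (pi_div_mul_lt g.pos (by omega)) (pi_div_mul_lt g.pos (by omega))
    (pi_div_mul_lt_add g.pos (by omega))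

theorem gapChord_gapPt_neg {d : ℕ} {g h k : Fin d} (hgh : g < h) (hk : k < g ∨ h < k) :
    gapChord d g h (gapPt d k) < 0 := by
  rw [gapPt_eq, gapChord, gapAngle_eq_cast, gapAngle_eq_cast, gapAngle_eq_cast]
  have hh := h.2
  have hk2 := k.2
  simp only [Fin.lt_def] at hgh hk
  rcases hk with h1 | h1
  · exact chordMap_exp_neg_of_lt (pi_div_mul_lt g.pos (by omega)) (pi_div_mul_lt g.pos (by omega))
      (pi_div_mul_lt_add g.pos (by omega))
  · exact chordMap_exp_neg_of_gt (pi_div_mul_lt g.pos (by omega)) (pi_div_mul_lt g.pos (by omega))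
      (pi_div_mul_lt_add g.pos (by omega))

theorem gapChord_boundaryPt_ne_zero {d : ℕ} {g h : Fin d} (hgh : g < h) (i : Fin d) :
    gapChord d g h (boundaryPt d i) ≠ 0 := by
  by_cases hi : (g < i) ↔ (h < i)
  · exact (gapChord_boundaryPt_neg hgh hi).ne
  · exact (gapChord_boundaryPt_pos hgh hi).ne'

theorem gapChord_boundaryPt_mul_pos_iff {d : ℕ} {g h i j : Fin d} (hgh : g < h) :
    0 < gapChord d g h (boundaryPt d i) * gapChord d g h (boundaryPt d j) ↔
      (((g < i) ↔ (h < i)) ↔ ((g < j) ↔ (h < j))) := by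
  by_cases hi : (g < i) ↔ (h < i) <;> by_cases hj : (g < j) ↔ (h < j)
  · exact iff_of_true (mul_pos_of_neg_of_neg (gapChord_boundaryPt_neg hgh hi)
      (gapChord_boundaryPt_neg hgh hj)) (iff_of_true hi hj)
  · exact iff_of_false (mul_neg_of_neg_of_pos (gapChord_boundaryPt_neg hgh hi)
      (gapChord_boundaryPt_pos hgh hj)).not_gt fun h => hj (h.1 hi)
  · exact iff_of_false (mul_neg_of_pos_of_neg (gapChord_boundaryPt_pos hgh hi)
      (gapChord_boundaryPt_neg hgh hj)).not_gt fun h => hi (h.2 hj)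
  · exact iff_of_true (mul_pos (gapChord_boundaryPt_pos hgh hi)
      (gapChord_boundaryPt_pos hgh hj)) (iff_of_false hi hj)

/-- A chord does not separate a gap which is not one of its ends from the adjacent points. -/
theorem gapChord_gapPt_mul_pos {d : ℕ} {g h k : Fin d} (hgh : g < h) (hg : k ≠ g) (hh : k ≠ h) :
    0 < gapChord d g h (gapPt d k) * gapChord d g h (boundaryPt d k) ∧
      0 < gapChord d g h (gapPt d k) * gapChord d g h (boundaryPt d (finRotate d k)) := by
  have e := coe_finRotate_eq k
  have h2 := h.2
  have k2 := k.2
  rw [ne_eq, Fin.ext_iff] at hg hh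
  by_cases hk : g < k ∧ k < h
  · have hpos := gapChord_gapPt_pos hk.1 hk.2
    refine ⟨mul_pos hpos (gapChord_boundaryPt_pos hgh ?_),
      mul_pos hpos (gapChord_boundaryPt_pos hgh ?_)⟩ <;>
    · simp only [Fin.lt_def] at *
      split_ifs at e <;> omega
  · have hneg := gapChord_gapPt_neg (k := k) hgh (by simp only [Fin.lt_def] at *; omega)
    refine ⟨mul_pos_of_neg_of_neg hneg (gapChord_boundaryPt_neg hgh ?_),
      mul_pos_of_neg_of_neg hneg (gapChord_boundaryPt_neg hgh ?_)⟩ <;>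
    · simp only [Fin.lt_def] at *
      split_ifs at e <;> omega

/-- A chord separates the points adjacent to one of its ends. -/
theorem gapChord_boundaryPt_mul_neg {d : ℕ} {g h : Fin d} (hgh : g < h) :
    ¬ 0 < gapChord d g h (boundaryPt d g) * gapChord d g h (boundaryPt d (finRotate d g)) := by
  have e := coe_finRotate_eq g
  have h2 := h.2
  rw [gapChord_boundaryPt_mul_pos_iff hgh]
  simp only [Fin.lt_def] at *
  split_ifs at e <;> omega

/-! ### Regions of a crossingless pairing -/

/-- A crossingless pairing of the gaps. -/
structure GapPairing (d : ℕ) where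
  /-- The gap paired with a gap. -/
  partner : Fin d → Fin d
  partner_partner : ∀ g, partner (partner g) = g
  partner_ne : ∀ g, partner g ≠ g
  noncrossing : ∀ g h, ¬ (g < h ∧ h < partner g ∧ partner g < partner h)

namespace GapPairing

variable {d : ℕ} (P : GapPairing d)

/-- A pair of gaps, given by its first gap. -/
abbrev Pair : Type := {g : Fin d // g < P.partner g}

/-- The affine function which vanishes on the chord of a pair. -/
def chord (a : P.Pair) : ℂ →ᵃ[ℝ] ℝ := gapChord d a (P.partner a)

/-- The union of the chords. -/
def chords : Set ℂ := ⋃ a : P.Pair, {w ∈ closedDisk | P.chord a w = 0}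

/-- The side of each chord on which a point lies is the same for `z` and `w`. -/
def SameSide (z w : ℂ) : Prop := ∀ a, 0 < P.chord a z * P.chord a w

variable {P}

theorem SameSide.symm {z w : ℂ} (h : P.SameSide z w) : P.SameSide w z := fun a => by
  rw [mul_comm]; exact h a

theorem SameSide.trans {z w y : ℂ} (h : P.SameSide z w) (h' : P.SameSide w y) : P.SameSide z y :=
  fun a => mul_pos_trans (h a) (h' a)

/-- Chords are indexed by the first gap of a pair, but replacing `g` by its partner only reverses
the inner equivalences, so all gaps may be quantified over. -/
theorem sameSide_boundaryPt_iff {i j : Fin d} : P.SameSide (boundaryPt d i) (boundaryPt d j) ↔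
    ∀ g, ((g < i) ↔ (P.partner g < i)) ↔ ((g < j) ↔ (P.partner g < j)) := by
  refine ⟨fun h g => ?_, fun h a => (gapChord_boundaryPt_mul_pos_iff a.2).2 (h a)⟩
  rcases lt_or_gt_of_ne (P.partner_ne g) with h1 | h1
  · have h2 := (gapChord_boundaryPt_mul_pos_iff
      (g := P.partner g) (h := P.partner (P.partner g)) (by rwa [P.partner_partner])).1
        (h ⟨P.partner g, by rwa [P.partner_partner]⟩)
    rw [P.partner_partner] at h2
    exact ⟨fun h => (h2.1 h.symm).symm, fun h => (h2.2 h.symm).symm⟩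
  · exact (gapChord_boundaryPt_mul_pos_iff h1).1 (h ⟨g, h1⟩)

theorem ne_of_pair_ne {a b : P.Pair} (h : a ≠ b) :
    (a : Fin d) ≠ b ∧ (a : Fin d) ≠ P.partner b ∧
      P.partner a ≠ b ∧ P.partner a ≠ P.partner b := by
  have h1 : (a : Fin d) ≠ b := fun e => h (Subtype.ext e)
  refine ⟨h1, fun e => ?_, fun e => ?_, fun e => h1 ?_⟩
  · have ha := a.2
    have hb := b.2
    rw [e, P.partner_partner] at ha
    exact ha.asymm hb
  · have ha := a.2
    have hb := b.2
    rw [← e, P.partner_partner] at hb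
    exact ha.asymm hb
  · rw [← P.partner_partner a, e, P.partner_partner]

/-- A chord does not separate the ends of another chord. -/
theorem chord_gapPt_mul_pos {a b : P.Pair} (h : a ≠ b) :
    0 < P.chord b (gapPt d a) * P.chord b (gapPt d (P.partner a)) := by
  obtain ⟨h1, h2, h3, h4⟩ := ne_of_pair_ne h
  have n1 := P.noncrossing a b
  have n2 := P.noncrossing b a
  have ha := a.2
  have hb := b.2
  rw [ne_eq, Fin.ext_iff] at h1 h2 h3 h4
  simp only [Fin.lt_def] at n1 n2 ha hb
  -- By noncrossing, the two ends of `a` lie either both between the ends of `b` or both outside.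
  by_cases hin : (b : Fin d) < a ∧ (a : Fin d) < P.partner b
  · have h5 : (b : Fin d) < P.partner a ∧ P.partner a < P.partner b := by
      simp only [Fin.lt_def] at hin ⊢
      omega
    exact mul_pos (gapChord_gapPt_pos hin.1 hin.2) (gapChord_gapPt_pos h5.1 h5.2)
  · have h5 : P.partner a < b ∨ P.partner b < P.partner a := by
      simp only [Fin.lt_def] at hin ⊢
      omega
    refine mul_pos_of_neg_of_neg (gapChord_gapPt_neg b.2 ?_) (gapChord_gapPt_neg b.2 h5)
    simp only [Fin.lt_def] at hin ⊢
    omega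

/-- The points of a chord lie on the same side of any other chord as its first end. -/
theorem chord_mul_pos_of_mem {a b : P.Pair} (h : a ≠ b) {w : ℂ} (hw : w ∈ closedDisk)
    (hw0 : P.chord a w = 0) : 0 < P.chord b w * P.chord b (gapPt d a) := by
  have hseg : w ∈ segment ℝ (gapPt d a) (gapPt d (P.partner a)) := by
    rw [segment_gapPt a.2]
    exact ⟨hw, hw0⟩
  have hab := chord_gapPt_mul_pos h
  have hconv : Convex ℝ {y | 0 < P.chord b (gapPt d a) * P.chord b y} :=
    Convex.affine_preimage (P.chord b)
      (convex_halfSpace_gt (IsLinearMap.isLinearMap_smul (P.chord b (gapPt d a))) 0)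
  have hne : P.chord b (gapPt d a) ≠ 0 := fun h0 => by
    rw [h0, zero_mul] at hab
    exact hab.false
  rw [mul_comm]
  exact hconv.segment_subset (mul_self_pos.2 hne) hab hseg

theorem chord_ne_zero_of_mem {a b : P.Pair} (h : a ≠ b) {w : ℂ} (hw : w ∈ closedDisk)
    (hw0 : P.chord a w = 0) : P.chord b w ≠ 0 := fun h0 => by
  have := chord_mul_pos_of_mem h hw hw0
  rw [h0, zero_mul] at this
  exact this.false

/-- The points of a chord lie on the same side of any other chord as the two boundary points
adjacent to its first end. -/
theorem chord_boundaryPt_mul_pos {a b : P.Pair} (h : b ≠ a) {w : ℂ} (hw : w ∈ closedDisk)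
    (hw0 : P.chord a w = 0) : 0 < P.chord b w * P.chord b (boundaryPt d a) ∧
      0 < P.chord b w * P.chord b (boundaryPt d (finRotate d a)) := by
  obtain ⟨h1, h2, -, -⟩ := ne_of_pair_ne h.symm
  have h3 := chord_mul_pos_of_mem h.symm hw hw0
  obtain ⟨h4, h5⟩ := gapChord_gapPt_mul_pos b.2 h1 h2
  exact ⟨mul_pos_trans h3 h4, mul_pos_trans h3 h5⟩

/-- Exactly one of the two boundary points adjacent to an end of a chord lies on a given side. -/
theorem chord_boundaryPt_or (a : P.Pair) {r : ℝ} (hr : r ≠ 0) :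
    (0 < r * P.chord a (boundaryPt d a) ∧ r * P.chord a (boundaryPt d (finRotate d a)) < 0) ∨
      (r * P.chord a (boundaryPt d a) < 0 ∧ 0 < r * P.chord a (boundaryPt d (finRotate d a))) := by
  have h1 := gapChord_boundaryPt_ne_zero a.2 a
  have h2 := gapChord_boundaryPt_ne_zero a.2 (finRotate d a)
  have h3 := gapChord_boundaryPt_mul_neg a.2
  change ¬ 0 < P.chord a _ * P.chord a _ at h3
  change P.chord a _ ≠ 0 at h1 h2
  rcases lt_or_gt_of_ne (mul_ne_zero hr h1) with h4 | h4 <;>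
    rcases lt_or_gt_of_ne (mul_ne_zero hr h2) with h5 | h5
  · rw [← neg_pos, ← neg_mul, mul_comm] at h4
    rw [← neg_pos, ← neg_mul] at h5
    exact (h3 (mul_pos_trans h4 h5)).elim
  · exact Or.inr ⟨h4, h5⟩
  · exact Or.inl ⟨h4, h5⟩
  · rw [mul_comm] at h4
    exact (h3 (mul_pos_trans h4 h5)).elim

/-- Every piece of the disk contains a boundary point. -/
theorem exists_sameSide_boundaryPt (hd : 0 < d) {z : ℂ} (hz : z ∈ closedDisk)
    (hz0 : ∀ a, P.chord a z ≠ 0) : ∃ i, P.SameSide z (boundaryPt d i) := by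
  have : Nonempty P.Pair := by
    let g : Fin d := ⟨0, hd⟩
    rcases lt_or_gt_of_ne (P.partner_ne g) with h | h
    · exact ⟨P.partner g, by rwa [P.partner_partner]⟩
    · exact ⟨g, h⟩
  -- No other chord separates `z` from the nearest chord `a`, nor from the two boundary points next
  -- to its first end. These two lie on opposite sides of `a`, so one of them is on the side of `z`.
  obtain ⟨a, w, hw, hw0, hvis⟩ := exists_visible_chord (f := P.chord) (convex_closedBall _ _)
    (isCompact_closedBall 0 1) (fun a => ⟨gapPt d a, gapPt_mem _, gapChord_left _ _⟩)
    (fun a b hab w hw hw0 => chord_ne_zero_of_mem hab hw hw0) hz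
  have key : ∀ b, b ≠ a → 0 < P.chord b z * P.chord b (boundaryPt d a) ∧
      0 < P.chord b z * P.chord b (boundaryPt d (finRotate d a)) := fun b hb => by
    obtain ⟨h1, h2⟩ := chord_boundaryPt_mul_pos hb hw hw0
    exact ⟨mul_pos_trans (hvis b hb) h1, mul_pos_trans (hvis b hb) h2⟩
  rcases chord_boundaryPt_or a (hz0 a) with h | h
  · refine ⟨a, fun b => ?_⟩
    rcases eq_or_ne b a with rfl | hb
    · exact h.1
    · exact (key b hb).1
  · refine ⟨finRotate d a, fun b => ?_⟩
    rcases eq_or_ne b a with rfl | hb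
    · exact h.2
    · exact (key b hb).2

theorem isRegion_chords_iff {R : Set ℂ} : IsRegion P.chords R ↔
    ∃ z ∈ closedDisk, (∀ a, P.chord a z ≠ 0) ∧ R = {w ∈ closedDisk | P.SameSide z w} := by
  constructor
  · rintro ⟨z, ⟨hz, hzc⟩, rfl⟩
    have hz0 : ∀ a, P.chord a z ≠ 0 := fun a h => hzc (Set.mem_iUnion.2 ⟨a, hz, h⟩)
    exact ⟨z, hz, hz0, connectedComponentIn_eq_of_affine (convex_closedBall _ _) hz hz0⟩
  · rintro ⟨z, hz, hz0, rfl⟩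
    refine ⟨z, ⟨hz, fun h => ?_⟩,
      (connectedComponentIn_eq_of_affine (convex_closedBall _ _) hz hz0).symm⟩
    obtain ⟨a, -, ha⟩ := Set.mem_iUnion.1 h
    exact hz0 a ha

theorem chord_boundaryPt_ne_zero (i : Fin d) (a : P.Pair) : P.chord a (boundaryPt d i) ≠ 0 :=
  gapChord_boundaryPt_ne_zero a.2 i

theorem sameSide_boundaryPt_self (i : Fin d) : P.SameSide (boundaryPt d i) (boundaryPt d i) :=
  fun a => mul_self_pos.2 (chord_boundaryPt_ne_zero i a)

/-- The regions are the pieces given by the boundary points. -/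
theorem exists_eq_of_isRegion (hd : 0 < d) {R : Set ℂ} (hR : IsRegion P.chords R) :
    ∃ i, R = {w ∈ closedDisk | P.SameSide (boundaryPt d i) w} := by
  obtain ⟨z, hz, hz0, rfl⟩ := isRegion_chords_iff.1 hR
  obtain ⟨i, hi⟩ := exists_sameSide_boundaryPt hd hz hz0
  exact ⟨i, Set.ext fun w => and_congr_right fun _ => ⟨hi.symm.trans, hi.trans⟩⟩

/-- Two distinct regions whose closures meet contain cyclically consecutive boundary points. -/
theorem exists_consecutive_of_closure_inter {i j : Fin d}
    (hij : ¬ P.SameSide (boundaryPt d i) (boundaryPt d j))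
    (hcl : (closure {w ∈ closedDisk | P.SameSide (boundaryPt d i) w} ∩
      closure {w ∈ closedDisk | P.SameSide (boundaryPt d j) w}).Nonempty) :
    ∃ g, (P.SameSide (boundaryPt d i) (boundaryPt d g) ∧
        P.SameSide (boundaryPt d j) (boundaryPt d (finRotate d g))) ∨
      (P.SameSide (boundaryPt d j) (boundaryPt d g) ∧
        P.SameSide (boundaryPt d i) (boundaryPt d (finRotate d g))) := by
  obtain ⟨w, hwi, hwj⟩ := hcl
  have hclosed : ∀ k, w ∈ closure {w ∈ closedDisk | P.SameSide (boundaryPt d k) w} →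
      w ∈ closedDisk ∧ ∀ a, 0 ≤ P.chord a (boundaryPt d k) * P.chord a w := by
    intro k hk
    have hc : IsClosed {w ∈ closedDisk | ∀ a, 0 ≤ P.chord a (boundaryPt d k) * P.chord a w} := by
      simp only [Set.ofPred_and, Set.ofPred_forall]
      exact Metric.isClosed_closedBall.inter (isClosed_iInter fun a => isClosed_le continuous_const
        (continuous_const.mul (P.chord a).continuous_of_finiteDimensional))
    have hsub : {w ∈ closedDisk | P.SameSide (boundaryPt d k) w} ⊆
        {w ∈ closedDisk | ∀ a, 0 ≤ P.chord a (boundaryPt d k) * P.chord a w} :=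
      fun y hy => ⟨hy.1, fun a => (hy.2 a).le⟩
    exact closure_minimal hsub hc hk
  obtain ⟨hw, hi⟩ := hclosed i hwi
  obtain ⟨-, hj⟩ := hclosed j hwj
  obtain ⟨a, ha⟩ := not_forall.1 hij
  have hi0 := chord_boundaryPt_ne_zero i a
  have hj0 := chord_boundaryPt_ne_zero j a
  -- The chord `a` separates `i` from `j`, and `w` lies in the closure of both sides, hence on `a`.
  -- Other chords miss `w`, so there the weak inequalities become strict.
  have hw0 : P.chord a w = 0 := by
    by_contra hw0
    have h1 := (hi a).lt_of_ne (mul_ne_zero hi0 hw0).symm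
    have h2 := (hj a).lt_of_ne (mul_ne_zero hj0 hw0).symm
    rw [mul_comm] at h2
    exact ha (mul_pos_trans h1 h2)
  have key : ∀ k, (∀ a, 0 ≤ P.chord a (boundaryPt d k) * P.chord a w) → ∀ b, b ≠ a →
      0 < P.chord b (boundaryPt d k) * P.chord b (boundaryPt d a) ∧
      0 < P.chord b (boundaryPt d k) * P.chord b (boundaryPt d (finRotate d a)) := by
    intro k hk b hb
    obtain ⟨h1, h2⟩ := chord_boundaryPt_mul_pos hb hw hw0
    have h3 := (hk b).lt_of_ne (mul_ne_zero (chord_boundaryPt_ne_zero k b)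
      (chord_ne_zero_of_mem hb.symm hw hw0)).symm
    exact ⟨mul_pos_trans h3 h1, mul_pos_trans h3 h2⟩
  have hfst : ∀ k, (∀ a, 0 ≤ P.chord a (boundaryPt d k) * P.chord a w) →
      0 < P.chord a (boundaryPt d k) * P.chord a (boundaryPt d a) →
      P.SameSide (boundaryPt d k) (boundaryPt d a) := by
    intro k hk h b
    rcases eq_or_ne b a with rfl | hb
    · exact h
    · exact (key k hk b hb).1
  have hsnd : ∀ k, (∀ a, 0 ≤ P.chord a (boundaryPt d k) * P.chord a w) →
      0 < P.chord a (boundaryPt d k) * P.chord a (boundaryPt d (finRotate d a)) →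
      P.SameSide (boundaryPt d k) (boundaryPt d (finRotate d a)) := by
    intro k hk h b
    rcases eq_or_ne b a with rfl | hb
    · exact h
    · exact (key k hk b hb).2
  refine ⟨a, ?_⟩
  rcases chord_boundaryPt_or a hi0 with h1 | h1 <;> rcases chord_boundaryPt_or a hj0 with h2 | h2
  · exact (ha (mul_pos_trans h1.1 (by rw [mul_comm]; exact h2.1))).elim
  · exact Or.inl ⟨hfst i hi h1.1, hsnd j hj h2.2⟩
  · exact Or.inr ⟨hfst j hj h2.1, hsnd i hi h1.2⟩
  · exact (ha (mul_pos_trans h1.2 (by rw [mul_comm]; exact h2.2))).elim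

/-- The chord between the boundary points `g` and `h` separates the two gap points: gap `g` lies on
the arc from `g` to `h`, gap `h` just beyond it. -/
theorem gapPt_ne {g h : Fin d} (hgh : g < h) : gapPt d g ≠ gapPt d h := by
  intro e
  have h2 := h.2
  rw [Fin.lt_def] at hgh
  have h1 : 0 < chordMap (boundaryAngle d g) (boundaryAngle d h) (gapPt d g) := by
    rw [gapPt_eq, boundaryAngle_eq_cast, boundaryAngle_eq_cast, gapAngle_eq_cast]
    exact chordMap_exp_pos (pi_div_mul_lt g.pos (by omega)) (pi_div_mul_lt g.pos (by omega))
      (pi_div_mul_lt_add g.pos (by omega))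
  have h2 : chordMap (boundaryAngle d g) (boundaryAngle d h) (gapPt d h) < 0 := by
    rw [gapPt_eq, boundaryAngle_eq_cast, boundaryAngle_eq_cast, gapAngle_eq_cast]
    exact chordMap_exp_neg_of_gt (pi_div_mul_lt g.pos (by omega)) (pi_div_mul_lt g.pos (by omega))
      (pi_div_mul_lt_add g.pos (by omega))
  rw [e] at h1
  exact h1.asymm h2

end GapPairing

/-! ### The matching by straight strands -/

namespace GapPairing

variable {d : ℕ} (P : GapPairing d)

/-- The straight strand of a pair. -/
def strand (a : P.Pair) (b : Bool) : Fin d := if b then P.partner a else a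

/-- The straight strand of a pair, as a path. -/
def strandPath (a : P.Pair) : Path (gapPt d (P.strand a false)) (gapPt d (P.strand a true)) :=
  Path.segment _ _

theorem range_strandPath (a : P.Pair) :
    Set.range (P.strandPath a) = {w ∈ closedDisk | P.chord a w = 0} := by
  rw [strandPath, Path.range_segment]
  exact segment_gapPt a.2

theorem iUnion_range_strandPath : ⋃ a, Set.range (P.strandPath a) = P.chords :=
  Set.iUnion_congr P.range_strandPath

theorem existsUnique_strand (i : Fin d) :
    ∃! p : P.Pair × Bool, P.strand p.1 p.2 = i := by
  rcases lt_or_gt_of_ne (P.partner_ne i) with h | h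
  · refine ⟨(⟨P.partner i, by rwa [P.partner_partner]⟩, true), by simp [strand, P.partner_partner],
      ?_⟩
    rintro ⟨⟨a, ha⟩, _ | _⟩ rfl
    · exact (h.asymm ha).elim
    · simp [strand, P.partner_partner]
  · refine ⟨(⟨i, h⟩, false), by simp [strand], ?_⟩
    rintro ⟨⟨a, ha⟩, _ | _⟩ rfl
    · simp [strand]
    · simp only [strand, if_true, P.partner_partner] at h
      exact (h.asymm ha).elim

theorem strandPath_mem_openDisk (a : P.Pair) {t : I} (ht : t ∈ Set.Ioo (0 : I) 1) :
    P.strandPath a t ∈ openDisk := by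
  have h1 := (strictConvex_closedBall ℝ (0 : ℂ) 1).openSegment_subset
    (gapPt_mem (a : Fin d)) (gapPt_mem (P.partner a)) (gapPt_ne a.2)
  rw [interior_closedBall _ one_ne_zero] at h1
  refine h1 ?_
  rw [openSegment_eq_image_lineMap]
  exact ⟨t, ⟨ht.1, ht.2⟩, rfl⟩

theorem strandPath_injective : Function.Injective (fun p : P.Pair × I => P.strandPath p.1 p.2) := by
  rintro ⟨a, s⟩ ⟨b, t⟩ h
  simp only at h
  have ha : P.strandPath a s ∈ {w ∈ closedDisk | P.chord a w = 0} := by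
    rw [← range_strandPath]; exact ⟨s, rfl⟩
  have hb : P.strandPath b t ∈ {w ∈ closedDisk | P.chord b w = 0} := by
    rw [← range_strandPath]; exact ⟨t, rfl⟩
  have hab : a = b := by
    by_contra hab
    exact chord_ne_zero_of_mem hab ha.1 ha.2 (h ▸ hb.2)
  subst hab
  rw [Path.segment_injective_of_ne (gapPt_ne a.2) h]

variable {P}

/-- The region around a boundary point. -/
def piece (P : GapPairing d) (i : Fin d) : Set ℂ :=
  {w ∈ closedDisk | P.SameSide (boundaryPt d i) w}

theorem isRegion_piece (i : Fin d) : IsRegion P.chords (P.piece i) :=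
  isRegion_chords_iff.2 ⟨_, boundaryPt_mem i, chord_boundaryPt_ne_zero i, rfl⟩

theorem boundaryPt_mem_piece {i j : Fin d} :
    boundaryPt d j ∈ P.piece i ↔ P.SameSide (boundaryPt d i) (boundaryPt d j) :=
  ⟨fun h => h.2, fun h => ⟨boundaryPt_mem j, h⟩⟩

theorem piece_eq_iff {i j : Fin d} :
    P.piece i = P.piece j ↔ P.SameSide (boundaryPt d i) (boundaryPt d j) :=
  ⟨fun h => boundaryPt_mem_piece.1 (h ▸ boundaryPt_mem_piece.2 (sameSide_boundaryPt_self j)),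
    fun h => Set.ext fun _ => and_congr_right fun _ => ⟨h.symm.trans, h.trans⟩⟩

/-- The regions between the strands are the pieces given by the boundary points. -/
theorem exists_eq_piece (hd : 0 < d) {R : Set ℂ}
    (hR : IsRegion (⋃ a, Set.range (P.strandPath a)) R) : ∃ i, R = P.piece i := by
  rw [P.iUnion_range_strandPath] at hR
  exact exists_eq_of_isRegion hd hR

/-- The matching by straight strands, with regions colored according to their boundary points. -/
def matching {S : Type*} (hd : 0 < d) (P : GapPairing d) (x : Fin d → S)
    (hx : ∀ i j, P.SameSide (boundaryPt d i) (boundaryPt d j) → x i = x j)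
    (hx' : ∀ i, x i ≠ x (finRotate d i)) : ColoredCrossinglessMatching S d where
  Strand := P.Pair
  endpt := P.strand
  matched := P.existsUnique_strand
  arc := P.strandPath
  embedded := P.strandPath_injective
  arc_mem a _ ht := P.strandPath_mem_openDisk a ht
  color R := x (exists_eq_piece hd R.2).choose
  color_adjacent R R' hne hcl := by
    have hR := (exists_eq_piece hd R.2).choose_spec
    have hR' := (exists_eq_piece hd R'.2).choose_spec
    set i := (exists_eq_piece hd R.2).choose
    set j := (exists_eq_piece hd R'.2).choose
    have hij : ¬ P.SameSide (boundaryPt d i) (boundaryPt d j) := fun h =>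
      hne (Subtype.ext (hR.trans ((piece_eq_iff.2 h).trans hR'.symm)))
    rw [hR, hR'] at hcl
    -- Adjacent regions contain consecutive boundary points, whose colors differ. By `hx` these are
    -- the colors of the regions, whichever boundary points were chosen to define them.
    obtain ⟨g, ⟨h1, h2⟩ | ⟨h1, h2⟩⟩ := exists_consecutive_of_closure_inter hij hcl
    · rw [hx i g h1, hx j _ h2]
      exact hx' g
    · rw [hx j g h1, hx i _ h2]
      exact (hx' g).symm

end GapPairing

/-- The pairing of the gaps of a noncrossing partition all of whose gap classes have two
elements. -/
theorem exists_gapPairing {K : Type*} {d : ℕ} {π : Fin d → K} (hπ : IsNoncrossing π)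
    (h2 : ∀ g, ∃ h, h ≠ g ∧ ∀ k, (gapSetoid π).r g k ↔ k = g ∨ k = h) :
    ∃ P : GapPairing d, ∀ i j, P.SameSide (boundaryPt d i) (boundaryPt d j) ↔ π i = π j := by
  choose f hne hf using h2
  have hr : ∀ g, (gapSetoid π).r g (f g) := fun g => (hf g _).2 (Or.inr rfl)
  refine ⟨⟨f, fun g => ?_, hne, fun g h hcross => ?_⟩, fun i j => ?_⟩
  · rcases (hf (f g) g).1 ((gapSetoid π).symm (hr g)) with h | h
    · exact (hne g h.symm).elim
    · exact h.symm
  -- Crossing pairs would lie in one class, making `h` a third element of `{g, f g}`.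
  · have hgh := gapSetoid_noncrossing (hr g) (hr h) hcross.1 hcross.2.1 hcross.2.2
    rcases (hf g h).1 hgh with e | e
    · exact hcross.1.ne' e
    · exact hcross.2.1.ne e
  · rw [GapPairing.sameSide_boundaryPt_iff]
    constructor
    · intro hs
      by_contra hij
      obtain ⟨g, h, hgh, hsep⟩ := exists_gapSetoid_separating hπ hij
      rcases (hf g h).1 hgh with rfl | rfl
      · exact hsep (by simp)
      · exact hsep (hs g)
    · intro hij g
      exact iff_interchange (hr g i j hij)

end

/-! ### The degree bound and the extremal case -/

theorem mainTheorem6 {S : Type*} {𝕜 : Type*} [CommRing 𝕜] {ι : Type*} {d : ℕ} (hd : 0 < d)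
    (x : Fin d → S) (G : SoergelGraph 𝕜 ι x) (hG : G.MaximallyConnected) :
    (2 : ℤ) - (repetitions x : ℤ) ≤ G.degree ∧
      (repetitions x = 0 → G.degree = 2 →
        ∃ M : ColoredCrossinglessMatching S d, G.IsDeformationRetractOf M) := by
  have hdeg := SoergelGraph.degree_eq hG.simple.trees hG.no_poly
  have hπ : IsNoncrossing fun i => G.comp (Sum.inr i) := fun i k j l =>
    SoergelGraph.comp_eq_of_interlaced hG.simple.trees
  have hx : ∀ i j, G.comp (Sum.inr i) = G.comp (Sum.inr j) → x i = x j := fun i j =>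
    SoergelGraph.color_eq_of_comp_eq
  have : Finite G.Component := Quot.finite _
  obtain ⟨h1, h2⟩ := two_mul_card_sub_le hd hπ hx
  refine ⟨by omega, fun h0 hdeg2 => ?_⟩
  obtain ⟨P, hP⟩ := exists_gapPairing hπ (h2 h0 (by omega))
  have hx' : ∀ i, x i ≠ x (finRotate d i) := by
    intro i hi
    rw [repetitions, Nat.card_eq_zero] at h0
    rcases h0 with h0 | h0
    · exact h0.elim ⟨i, hi⟩
    · exact not_finite_iff_infinite.2 h0 inferInstance
  let M := P.matching hd x (fun i j h => hx i j ((hP i j).1 h)) hx'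
  have hchoose : ∀ R : M.Region, ∃ i, (R : Set ℂ) = P.piece i ∧ M.color R = x i := fun R =>
    ⟨_, (GapPairing.exists_eq_piece hd R.2).choose_spec, rfl⟩
  choose i hi hcol using hchoose
  refine ⟨M, hG.simple, hG.no_poly, Equiv.ofBijective (fun R => G.comp (Sum.inr (i R))) ⟨?_, ?_⟩,
    fun R j => ?_, fun R e he => ?_⟩
  · intro R R' h
    exact Subtype.ext ((hi R).trans ((GapPairing.piece_eq_iff.2 ((hP _ _).2 h)).trans (hi R').symm))
  -- Every component meets the boundary, so it is reached from the region of one of its boundary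
  -- points.
  · intro c
    obtain ⟨j, rfl⟩ := hG.simple.boundary_nonempty c
    let R : M.Region := ⟨P.piece j, by
      change IsRegion (⋃ a, Set.range (P.strandPath a)) _
      rw [P.iUnion_range_strandPath]
      exact GapPairing.isRegion_piece j⟩
    exact ⟨R, (hP _ _).1 (GapPairing.piece_eq_iff.1 (hi R).symm)⟩
  · rw [hi R, GapPairing.boundaryPt_mem_piece, hP]
    exact eq_comm
  · rw [hcol R]
    exact SoergelGraph.edgeColor_eq_of_comp_eq he.symm
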